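/- For $n\ge 0$ and permutations $\pi,\sigma$ of $[n]=\{1,\dots,n\}$ let $d_\alpha(\pi,\sigma)=\sum_{i=1}^n|\pi(i)-\sigma(i)|^\alpha$. The $L_\alpha$-Mallows distribution with central ranking $\sigma$ and dispersion $\beta$ is the probability distribution $\mathbb P_{\alpha,\beta,\sigma}(\pi)=e^{-\beta d_\alpha(\pi,\sigma)}/Z_n(\beta,\alpha)$ on $S_n$, where $Z_n(\beta,\alpha)=\sum_{\pi\in S_n}e^{-\beta d_\alpha(\pi,\sigma)}$ (which does not depend on $\sigma$). For $k\in\mathbb N$ let $A_n^{(k)}$ be the $n\times n$ matrix with entries $e^{-\beta|i-j|^\alpha}\mathbf 1_{\{|i-j|\le k\}}$, and let $\mathbb P^{(k)}_{\alpha,\beta,\sigma}$ be the distribution on $S_n$ with $\mathbb P^{(k)}_{\alpha,\beta,\sigma}(\pi)$ proportional to $\prod_{i=1}^n A_n^{(k)}[\sigma(i),\pi(i)]$. Algorithms are programs of a random access machine with a memory for integers and one for real numbers, whose program text is finite and contains no constants other than natural numbers. At unit cost it performs exact real arithmetic ($+,-,\times,/,\exp,\log$) and comparisons, integer addition, subtraction,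 division with remainder and comparisons, conversion of integers to reals, indirect addressing, and (if randomized) the toss of a coin whose bias is a computed real number. Theorem. For every $\alpha\ge 1$ and $\beta>0$ there is a fully polynomial-time approximation scheme for the $L_\alpha$-Mallows distribution. That is, there are a deterministic program (the estimator), a randomized program (the sampler), constants $C,D,K$ and band half-widths $k=k(n,\epsilon)\in\mathbb N$ with $k\le K\,(1+\log(1+n/\epsilon))$, all depending only on $\alpha$ and $\beta$, such that for every $n\ge 0$ and every $\epsilon>0$: (i) on input $(n,\alpha,\beta,\epsilon)$ the estimator halts within $C\,(n+1/\epsilon+1)^D$ steps and returns $\hat Z=\operatorname{per}(A_n^{(k)})$, and $(1-\epsilon)\,Z_n(\beta,\alpha)\le \hat Z\le Z_n(\beta,\alpha)$; (ii) for every $\sigma\in S_n$, on input $(n,\alpha,\beta,\epsilon,\sigma)$ the sampler halts, for every outcome of its coins, within $C\,(n+1/\epsilon+1)^D$ steps and returns a random permutation with distribution exactly $\mathbb P^{(k)}_{\alpha,\beta,\sigma}$, and the total variation distance between $\mathbb P^{(k)}_{\alpha,\beta,\sigma}$ and $\mathbb P_{\alpha,\beta,\sigma}$ is at most $\epsilon$.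 -/

import Mathlib

noncomputable section

/-! ### The `L_α`-Mallows model -/

namespace Mallows

open Equiv

variable {n : ℕ}

/-- The distance `d_α(π, σ) = ∑ i, |π(i) - σ(i)| ^ α` between two rankings. -/
def dist (α : ℝ) (π σ : Perm (Fin n)) : ℝ :=
  ∑ i, |((π i : ℕ) : ℝ) - ((σ i : ℕ) : ℝ)| ^ α

/-- The partition function `∑ π, exp (-β d_α(π, σ))`. -/
def partitionFunction (α β : ℝ) (σ : Perm (Fin n)) : ℝ :=
  ∑ π : Perm (Fin n), Real.exp (-β * dist α π σ)

/-- The probability distribution on a finite type proportional to a nonnegative weight `w` that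
is positive somewhere. -/
def proportionalTo {Ω : Type*} [Fintype Ω] (w : Ω → ℝ) (h : ∃ a, 0 < w a) : PMF Ω :=
  PMF.normalize (fun a => ENNReal.ofReal (w a))
    (by
      obtain ⟨a, ha⟩ := h
      intro h0
      have := ENNReal.tsum_eq_zero.1 h0 a
      exact absurd (ENNReal.ofReal_eq_zero.1 this) (not_le.2 ha))
    (by
      rw [tsum_fintype]
      exact ENNReal.sum_ne_top.2 (fun a _ => ENNReal.ofReal_ne_top))

/-- The `L_α`-Mallows distribution with central ranking `σ` and dispersion `β`: the probability
of `π` is `exp (-β d_α(π, σ))` divided by the partition function. -/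
def mallows (α β : ℝ) (σ : Perm (Fin n)) : PMF (Perm (Fin n)) :=
  proportionalTo (fun π => Real.exp (-β * dist α π σ)) ⟨1, Real.exp_pos _⟩

/-- The weight matrix `exp (-β |i - j| ^ α)`, with the entries with `|i - j| > k` set to zero. -/
def bandMatrix (n : ℕ) (α β : ℝ) (k : ℕ) : Matrix (Fin n) (Fin n) ℝ :=
  fun i j =>
    if |((i : ℕ) : ℝ) - ((j : ℕ) : ℝ)| ≤ (k : ℝ) then
      Real.exp (-β * |((i : ℕ) : ℝ) - ((j : ℕ) : ℝ)| ^ α)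
    else 0

/-- The Mallows distribution truncated to the band of half-width `k`: the probability of `π` is
proportional to `∏ i, A (σ i) (π i)`, where `A` is the band matrix. -/
def truncatedMallows (α β : ℝ) (k : ℕ) (σ : Perm (Fin n)) : PMF (Perm (Fin n)) :=
  proportionalTo (fun π => ∏ i, bandMatrix n α β k (σ i) (π i))
    ⟨σ, Finset.prod_pos (fun i _ => by simp [bandMatrix, Real.exp_pos])⟩

/-- Total variation distance of two distributions on a finite type. -/
def tvDist {Ω : Type*} [Fintype Ω] (p q : PMF Ω) : ℝ :=
  (1 / 2) * ∑ a, |(p a).toReal - (q a).toReal|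

/-- A ranking as the list of its values, counted from `0`. -/
def values (π : Perm (Fin n)) : Fin n → ℕ := fun i => (π i : ℕ)

end Mallows

/-! ### Randomized real random access machines

A program is a fixed finite text over two memories, one for natural numbers and one for real
numbers; each consists of arrays with a fixed name and a computed index.
The only constants in a program are natural numbers.
Exact real arithmetic (with `exp` and `log`) and the comparison of reals have unit cost. There is
no rounding from reals to integers, and integers cannot be multiplied in unit time, so their length
grows by a bounded number of bits in each step. -/

namespace RealRAM

structure State where
  /-- `nat a i` is the cell with index `i` of the integer array with name `a`. -/
  nat : ℕ → ℕ → ℕ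
  /-- `real a i` is the cell with index `i` of the real array with name `a`. -/
  real : ℕ → ℕ → ℝ

/-- Integer expressions. -/
inductive NExpr where
  | const (c : ℕ)
  | load (a : ℕ) (idx : NExpr)
  | add (x y : NExpr)
  | sub (x y : NExpr)
  | div (x y : NExpr)
  | mod (x y : NExpr)

/-- Real expressions. -/
inductive RExpr where
  | ofNat (x : NExpr)
  | load (a : ℕ) (idx : NExpr)
  | add (x y : RExpr)
  | sub (x y : RExpr)
  | mul (x y : RExpr)
  | div (x y : RExpr)
  | exp (x : RExpr)
  | log (x : RExpr)

/-- Tests. -/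
inductive Test where
  | natLe (x y : NExpr)
  | realLe (x y : RExpr)
  | not (t : Test)
  | and (t u : Test)

/-- Programs. -/
inductive Prog where
  | skip
  | setNat (a : ℕ) (idx : NExpr) (x : NExpr)
  | setReal (a : ℕ) (idx : NExpr) (x : RExpr)
  | seq (p q : Prog)
  | ite (t : Test) (p q : Prog)
  | while (t : Test) (p : Prog)
  /-- Continue with `p` with probability `x` (clipped to `[0, 1]`), and with `q` otherwise, by
  a fresh independent coin. -/
  | flip (x : RExpr) (p q : Prog)

/-- Value of an integer expression: subtraction is truncated at `0`, `div` and `mod` are quotient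
and remainder. -/
def NExpr.eval (s : State) : NExpr → ℕ
  | .const c => c
  | .load a i => s.nat a (i.eval s)
  | .add x y => x.eval s + y.eval s
  | .sub x y => x.eval s - y.eval s
  | .div x y => x.eval s / y.eval s
  | .mod x y => x.eval s % y.eval s

def RExpr.eval (s : State) : RExpr → ℝ
  | .ofNat x => (x.eval s : ℝ)
  | .load a i => s.real a (i.eval s)
  | .add x y => x.eval s + y.eval s
  | .sub x y => x.eval s - y.eval s
  | .mul x y => x.eval s * y.eval s
  | .div x y => x.eval s / y.eval s
  | .exp x => Real.exp (x.eval s)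
  | .log x => Real.log (x.eval s)

def Test.holds (s : State) : Test → Prop
  | .natLe x y => x.eval s ≤ y.eval s
  | .realLe x y => x.eval s ≤ y.eval s
  | .not t => ¬ t.holds s
  | .and t u => t.holds s ∧ u.holds s

def State.setNat (s : State) (a i v : ℕ) : State :=
  { s with nat := Function.update s.nat a (Function.update (s.nat a) i v) }

def State.setReal (s : State) (a i : ℕ) (v : ℝ) : State :=
  { s with real := Function.update s.real a (Function.update (s.real a) i v) }

/-- A coin that shows `true` with probability `x`, clipped to `[0, 1]`. -/
def coin (x : ℝ) : PMF Bool :=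
  PMF.ofFintype
    (fun b => if b then ENNReal.ofReal (max 0 (min x 1)) else
      ENNReal.ofReal (1 - max 0 (min x 1)))
    (by
      have h0 : 0 ≤ max 0 (min x 1) := le_max_left _ _
      have h1 : max 0 (min x 1) ≤ 1 := max_le zero_le_one (min_le_right _ _)
      simp only [Fintype.sum_bool, if_true, Bool.false_eq_true, if_false]
      rw [← ENNReal.ofReal_add h0 (sub_nonneg.2 h1)]
      simp)

/-- The stack of programs still to be executed, and the memory. -/
abbrev Config := List Prog × State

open Classical in
/-- One step of the machine. The expressions in a program are fixed and finite, so that a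
step performs a number of elementary operations bounded by a constant of the program. -/
def step : Config → PMF Config
  | ([], s) => PMF.pure ([], s)
  | (.skip :: r, s) => PMF.pure (r, s)
  | (.setNat a i x :: r, s) => PMF.pure (r, s.setNat a (i.eval s) (x.eval s))
  | (.setReal a i x :: r, s) => PMF.pure (r, s.setReal a (i.eval s) (x.eval s))
  | (.seq p q :: r, s) => PMF.pure (p :: q :: r, s)
  | (.ite t p q :: r, s) => PMF.pure ((if t.holds s then p else q) :: r, s)
  | (.while t p :: r, s) => PMF.pure (if t.holds s then p :: .while t p :: r else r, s)
  | (.flip x p q :: r, s) =>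
      (coin (x.eval s)).bind fun b => PMF.pure ((if b then p else q) :: r, s)

/-- Distribution of the configuration after `T` steps. -/
def run : ℕ → Config → PMF Config
  | 0, c => PMF.pure c
  | T + 1, c => (step c).bind (run T)

/-- Started on `s`, the program halts within `T` steps, whatever the coins show. -/
def Prog.HaltsWithin (p : Prog) (s : State) (T : ℕ) : Prop :=
  ∀ c ∈ (run T ([p], s)).support, c.1 = []

/-- Distribution of the memory after `T` steps. -/
def Prog.memoryAfter (p : Prog) (s : State) (T : ℕ) : PMF State :=
  (run T ([p], s)).map Prod.snd

/-- The program tosses no coins. -/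
def Prog.Deterministic : Prog → Prop
  | .skip => True
  | .setNat _ _ _ => True
  | .setReal _ _ _ => True
  | .seq p q => p.Deterministic ∧ q.Deterministic
  | .ite _ p q => p.Deterministic ∧ q.Deterministic
  | .while _ p => p.Deterministic
  | .flip _ _ _ => False

/-- Input of the estimator: `n` in cell `0` of integer array `0`, and `α, β, ε` in cells
`0, 1, 2` of real array `0`; all other cells are `0`. -/
def input (n : ℕ) (α β ε : ℝ) : State where
  nat a i := if a = 0 ∧ i = 0 then n else 0
  real a i := if a = 0 then (if i = 0 then α else if i = 1 then β else if i = 2 then ε else 0)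
    else 0

/-- Input of the sampler: the same, with the central ranking in integer array `1`. -/
def inputWithCenter {n : ℕ} (α β ε : ℝ) (σ : Equiv.Perm (Fin n)) : State :=
  { input n α β ε with
    nat := fun a i =>
      if a = 1 then (if h : i < n then (σ ⟨i, h⟩ : ℕ) else 0) else (input n α β ε).nat a i }

/-- The real number that a program returns: cell `0` of real array `1`. -/
def State.realOutput (s : State) : ℝ := s.real 1 0

/-- The list of `n` integers that a program returns: cells `0, …, n - 1` of integer array `2`. -/
def State.listOutput (n : ℕ) (s : State) : Fin n → ℕ := fun i => s.nat 2 i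

end RealRAM

end

/-! Under the Mallows weight no point is likely to move far: a displacement beyond `K * t` has
probability at most `2 ^ (-t)` at each position and in each direction. Hence a band of half-width of
order `log (1 + n / ε)` carries all but a fraction `ε` of the weight. The weights inside the band
form a band matrix, and its permanent can be computed and sampled from exactly by dynamic
programming over `2 ^ (2 * k + 1)` column masks, which is polynomial in `n` and `1 / ε`.

The decay (`exists_tailWeight_le`) comes from two exchange arguments; right translation makes the
central ranking the identity. If many arcs `a → π a` cross a cut from left to right, equally many
cross back, and some of each kind reach far from the cut. Uncrossing one such pair saves energy
proportional to these distances (`cost_uncross`). The saving pays for remembering which pair was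
uncrossed and leaves an exponentially small factor, so many crossings are unlikely, even given the
value of one position (`sum_weight_many_arcs_le`). If few arcs cross the cuts at `i` and at `j`, a
long arc from `i` beyond `j` can trade its value with a position between `i` and `j` whose value
lies just below `j`. The Monge inequality says that this costs nothing, and at most `h` preimages
arise (`sum_weight_few_arcs_le`). Together the tail shrinks by a constant factor whenever `j`
advances by a constant (`tailWeight_contract`).

On the algorithmic side, `bandPermanent_eq_permanent` identifies the recursion over masks with the
permanent. Choosing the columns row by row in proportion to the terms of this recursion gives
exactly the truncated distribution (`chain_sampleStep_map`). The machine programs are verified by a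
Hoare logic in which the final memory is coupled with a prescribed random variable (`Triple`),
together with a worst-case bound on the number of steps. -/

namespace Mallows

open Equiv Finset

/-! ### Convexity on the integers, the Monge inequality and uncrossing -/

/-- The cost `|a - b| ^ α` of matching `a` with `b`. -/
noncomputable def cost (α : ℝ) (a b : ℕ) : ℝ := |(a : ℝ) - (b : ℝ)| ^ α

/-- The excess of `|t| ^ α` over `|t|`, on the integers. -/
noncomputable def excess (α : ℝ) (t : ℤ) : ℝ := |(t : ℝ)| ^ α - |(t : ℝ)|

theorem excess_neg (α : ℝ) (t : ℤ) : excess α (-t) = excess α t := by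
  simp [excess, abs_neg]

theorem rpow_second_difference {α : ℝ} (hα : 1 ≤ α) {x : ℝ} (hx : 0 ≤ x) :
    (x + 1) ^ α - x ^ α ≤ (x + 2) ^ α - (x + 1) ^ α := by
  have hy : x + 2 ∈ Set.Ici (0 : ℝ) := by simp only [Set.mem_Ici]; linarith
  have h := (convexOn_rpow hα).2 (Set.mem_Ici.2 hx) hy
    (show (0 : ℝ) ≤ 1 / 2 by norm_num) (show (0 : ℝ) ≤ 1 / 2 by norm_num) (by norm_num)
  have e : (1 / 2 : ℝ) • x + (1 / 2 : ℝ) • (x + 2) = x + 1 := by simp; ring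
  rw [e] at h
  simp only [smul_eq_mul] at h
  linarith

theorem excess_second_difference_of_nonneg {α : ℝ} (hα : 1 ≤ α) {t : ℤ} (ht : 0 ≤ t) :
    excess α (t + 1) - excess α t ≤ excess α (t + 2) - excess α (t + 1) := by
  have h0 : (0 : ℝ) ≤ t := by exact_mod_cast ht
  have := rpow_second_difference hα h0
  simp only [excess]
  push_cast
  rw [abs_of_nonneg h0, abs_of_nonneg (by linarith : (0 : ℝ) ≤ t + 1),
    abs_of_nonneg (by linarith : (0 : ℝ) ≤ t + 2)]
  linarith

/-- On the reals `|t| ^ α - |t|` fails to be convex at `0` for `α > 1`. On the integers it is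
convex, because it vanishes at `-1`, `0` and `1`. Splitting off `|t|` therefore leaves a Monge
remainder, and the gain available for `α = 1` survives for every `α ≥ 1`. -/
theorem excess_second_difference {α : ℝ} (hα : 1 ≤ α) (t : ℤ) :
    excess α (t + 1) - excess α t ≤ excess α (t + 2) - excess α (t + 1) := by
  rcases le_or_gt 0 t with ht | ht
  · exact excess_second_difference_of_nonneg hα ht
  · rcases eq_or_lt_of_le (show t ≤ -1 by omega) with rfl | h
    · have : α ≠ 0 := by linarith
      simp [excess, this]
    · have h := excess_second_difference_of_nonneg hα (t := -t - 2) (by omega)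
      rw [show -t - 2 + 1 = -(t + 1) by ring, show -t - 2 + 2 = -t by ring,
        show -t - 2 = -(t + 2) by ring, excess_neg, excess_neg, excess_neg] at h
      linarith

theorem excess_increment_monotone {α : ℝ} (hα : 1 ≤ α) :
    Monotone fun t : ℤ => excess α (t + 1) - excess α t := by
  refine monotone_int_of_le_succ fun t => ?_
  have := excess_second_difference hα t
  rw [show t + 1 + 1 = t + 2 by ring]
  exact this

theorem excess_sub_le {α : ℝ} (hα : 1 ≤ α) {x v : ℤ} (hxv : x ≤ v) (s : ℕ) :
    excess α (x + s) - excess α x ≤ excess α (v + s) - excess α v := by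
  induction s with
  | zero => simp
  | succ s ih =>
    have := excess_increment_monotone hα (show x + s ≤ v + s by omega)
    simp only at this
    push_cast
    rw [← add_assoc, ← add_assoc]
    linarith

theorem cost_eq (α : ℝ) (a b : ℕ) :
    cost α a b = excess α ((a : ℤ) - b) + |(a : ℝ) - b| := by
  simp [cost, excess]

/-- Moving the second argument from `b'` down to `b` gives increments of equal length `b' - b`,
starting at `a - b' ≤ a' - b'`; those of a convex function grow with the starting point. -/
theorem excess_monge {α : ℝ} (hα : 1 ≤ α) {a a' b b' : ℕ} (ha : a ≤ a') (hb : b ≤ b') :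
    excess α ((a : ℤ) - b) + excess α ((a' : ℤ) - b') ≤
      excess α ((a : ℤ) - b') + excess α ((a' : ℤ) - b) := by
  have h := excess_sub_le hα (x := (a : ℤ) - b') (v := (a' : ℤ) - b') (by omega) (b' - b)
  rw [show (a : ℤ) - b' + ((b' - b : ℕ) : ℤ) = a - b by omega,
    show (a' : ℤ) - b' + ((b' - b : ℕ) : ℤ) = a' - b by omega] at h
  linarith

/-- The cost satisfies the Monge inequality. -/
theorem cost_monge {α : ℝ} (hα : 1 ≤ α) {a a' b b' : ℕ} (ha : a ≤ a') (hb : b ≤ b') :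
    cost α a b + cost α a' b' ≤ cost α a b' + cost α a' b := by
  have h := excess_monge hα ha hb
  have ha' : (a : ℝ) ≤ a' := by exact_mod_cast ha
  have hb' : (b : ℝ) ≤ b' := by exact_mod_cast hb
  have h1 : |(a : ℝ) - b| + |(a' : ℝ) - b'| ≤ |(a : ℝ) - b'| + |(a' : ℝ) - b| := by
    rcases abs_cases ((a : ℝ) - b) with h1 | h1 <;> rcases abs_cases ((a' : ℝ) - b') with h2 | h2 <;>
    rcases abs_cases ((a : ℝ) - b') with h3 | h3 <;> rcases abs_cases ((a' : ℝ) - b) with h4 | h4 <;>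
    linarith
  simp only [cost_eq]
  linarith

/-- Uncrossing a forward arc `a → b` and a backward arc `d → c` over the cut `m` saves at least
twice the distances to the cut. -/
theorem cost_uncross {α : ℝ} (hα : 1 ≤ α) {a b c d m : ℕ} (ha : a ≤ m) (hc : c ≤ m) (hb : m < b)
    (hd : m < d) :
    cost α a c + cost α d b + 2 * ((min (m - a) (m - c) + min (b - m) (d - m) : ℕ) : ℝ) ≤
      cost α a b + cost α d c := by
  have h := excess_monge hα (show a ≤ d by omega) (show c ≤ b by omega)
  -- For absolute values the saving is exactly `2 * (min b d - max a c)`, and the cut `m` divides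
  -- this length into the two minima.
  have h1 : |(a : ℝ) - c| + |(d : ℝ) - b| + 2 * ((min (m - a) (m - c) + min (b - m) (d - m) : ℕ) : ℝ)
      ≤ |(a : ℝ) - b| + |(d : ℝ) - c| := by
    have : |(a : ℤ) - c| + |(d : ℤ) - b| + 2 * ((min (m - a) (m - c) + min (b - m) (d - m) : ℕ) : ℤ)
      ≤ |(a : ℤ) - b| + |(d : ℤ) - c| := by
      rcases abs_cases ((a : ℤ) - c) with h1 | h1 <;> rcases abs_cases ((d : ℤ) - b) with h2 | h2 <;>
      rcases abs_cases ((a : ℤ) - b) with h3 | h3 <;> rcases abs_cases ((d : ℤ) - c) with h4 | h4 <;>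
      omega
    exact_mod_cast this
  simp only [cost_eq]
  linarith

/-! ### Transpositions and arcs over a cut -/

variable {n : ℕ}

/-- The distance of a permutation to the identity. -/
noncomputable def energy (α : ℝ) (π : Perm (Fin n)) : ℝ := ∑ i : Fin n, cost α i (π i)

/-- The unnormalized Mallows weight with the identity as central ranking. -/
noncomputable def weight (α β : ℝ) (π : Perm (Fin n)) : ℝ := Real.exp (-β * energy α π)

theorem weight_pos (α β : ℝ) (π : Perm (Fin n)) : 0 < weight α β π := Real.exp_pos _

theorem energy_mul_swap (α : ℝ) (π : Perm (Fin n)) {a d : Fin n} (had : a ≠ d) :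
    energy α (π * swap a d) + (cost α a (π a) + cost α d (π d)) =
      energy α π + (cost α a (π d) + cost α d (π a)) := by
  have hd : d ∈ univ.erase a := by simp [had.symm]
  unfold energy
  rw [← add_sum_erase univ _ (mem_univ a), ← add_sum_erase _ _ hd,
    ← add_sum_erase univ (fun i : Fin n => cost α i (π i)) (mem_univ a), ← add_sum_erase _ _ hd]
  have : ∑ x ∈ (univ.erase a).erase d, cost α x ((π * swap a d) x) =
      ∑ x ∈ (univ.erase a).erase d, cost α x (π x) := by
    refine sum_congr rfl fun x hx => ?_
    simp only [mem_erase, mem_univ, and_true] at hx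
    rw [Perm.mul_apply, swap_apply_of_ne_of_ne hx.2 hx.1]
  rw [this]
  simp only [Perm.mul_apply, swap_apply_left, swap_apply_right]
  ring

/-- A bound on the total weight of `X` by that of `Y`, from a choice of a transposition that leads
from each element of `X` into `Y`. -/
theorem sum_weight_le_of_swap (w : Perm (Fin n) → ℝ) (X Y : Finset (Perm (Fin n)))
    (hw : ∀ π, 0 ≤ w π) (g : Perm (Fin n) → Fin n → Fin n → ℝ) (hg : ∀ π a d, 0 ≤ g π a d) (B : ℝ)
    (h : ∀ π ∈ X, ∃ a d, π * swap a d ∈ Y ∧ w π ≤ w (π * swap a d) * g (π * swap a d) a d)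
    (hB : ∀ π ∈ Y, ∑ a, ∑ d, g π a d ≤ B) :
    ∑ π ∈ X, w π ≤ B * ∑ π ∈ Y, w π := by
  classical
  rcases isEmpty_or_nonempty (Fin n) with hn | hn
  · have hX : X = ∅ := eq_empty_of_forall_notMem fun π hπ => hn.elim (h π hπ).choose
    rw [hX, sum_empty, mul_sum]
    refine sum_nonneg fun π hπ => mul_nonneg ?_ (hw π)
    exact (sum_nonneg fun a _ => sum_nonneg fun d _ => hg π a d).trans (hB π hπ)
  choose! a d hY hle using h
  calc ∑ π ∈ X, w π
      ≤ ∑ π ∈ X, w (π * swap (a π) (d π)) * g (π * swap (a π) (d π)) (a π) (d π) :=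
        sum_le_sum hle
    -- A permutation is recovered from its image together with the transposition, so no summand is
    -- counted twice.
    _ = ∑ x ∈ X.image (fun π => (π * swap (a π) (d π), a π, d π)),
          w x.1 * g x.1 x.2.1 x.2.2 := by
        rw [sum_image]
        intro π _ ρ _ h
        simp only [Prod.mk.injEq] at h
        obtain ⟨h1, h2, h3⟩ := h
        rw [h2, h3] at h1
        exact mul_right_cancel h1
    _ ≤ ∑ x ∈ Y ×ˢ (univ ×ˢ univ), w x.1 * g x.1 x.2.1 x.2.2 := by
        refine sum_le_sum_of_subset_of_nonneg ?_ fun x _ _ => mul_nonneg (hw _) (hg _ _ _)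
        intro x hx
        simp only [mem_image] at hx
        obtain ⟨π, hπ, rfl⟩ := hx
        simpa using hY π hπ
    _ = ∑ π ∈ Y, w π * ∑ a, ∑ d, g π a d := by
        rw [sum_product]
        refine sum_congr rfl fun π _ => ?_
        rw [sum_product, mul_sum]
        exact sum_congr rfl fun a _ => by rw [mul_sum]
    _ ≤ ∑ π ∈ Y, w π * B := sum_le_sum fun π hπ => mul_le_mul_of_nonneg_left (hB π hπ) (hw π)
    _ = B * ∑ π ∈ Y, w π := by rw [← sum_mul, mul_comm]

/-- The positions up to `m` with a value beyond `m`. -/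
def forwardArcs (m : ℕ) (π : Perm (Fin n)) : Finset (Fin n) := {a | (a : ℕ) ≤ m ∧ m < π a}

/-- The positions beyond `m` with a value up to `m`. -/
def backwardArcs (m : ℕ) (π : Perm (Fin n)) : Finset (Fin n) := {a | m < (a : ℕ) ∧ (π a : ℕ) ≤ m}

theorem mem_forwardArcs {m : ℕ} {π : Perm (Fin n)} {a : Fin n} :
    a ∈ forwardArcs m π ↔ (a : ℕ) ≤ m ∧ m < π a := by simp [forwardArcs]

/-- There are as many positions up to `m` as values up to `m`; discarding the positions that satisfy
both conditions leaves the two kinds of crossing arcs. -/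
theorem card_backwardArcs (m : ℕ) (π : Perm (Fin n)) :
    (backwardArcs m π).card = (forwardArcs m π).card := by
  have h1 : ({a | (a : ℕ) ≤ m} : Finset (Fin n)).card =
      ({a | ((π a : Fin n) : ℕ) ≤ m} : Finset (Fin n)).card := by
    refine (card_bij (fun a _ => π a) ?_ ?_ ?_).symm
    · simp
    · intro a _ b _ h; exact π.injective h
    · intro b hb; exact ⟨π.symm b, by simpa using hb, by simp⟩
  have h2 := card_filter_add_card_filter_not (s := ({a | (a : ℕ) ≤ m} : Finset (Fin n)))
    (fun a => ((π a : Fin n) : ℕ) ≤ m)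
  have h3 := card_filter_add_card_filter_not
    (s := ({a | ((π a : Fin n) : ℕ) ≤ m} : Finset (Fin n))) (fun a => (a : ℕ) ≤ m)
  have e1 : ({a ∈ ({a | (a : ℕ) ≤ m} : Finset (Fin n)) | ¬ ((π a : Fin n) : ℕ) ≤ m}) =
      forwardArcs m π := by ext a; simp [forwardArcs]
  have e2 : ({a ∈ ({a : Fin n | ((π a : Fin n) : ℕ) ≤ m} : Finset (Fin n)) | ¬ ((a : Fin n) : ℕ) ≤ m}) =
      backwardArcs m π := by ext a; simp [backwardArcs, and_comm]
  have e3 : ({a ∈ ({a | (a : ℕ) ≤ m} : Finset (Fin n)) | ((π a : Fin n) : ℕ) ≤ m}) =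
    ({a ∈ ({a : Fin n | ((π a : Fin n) : ℕ) ≤ m} : Finset (Fin n)) | ((a : Fin n) : ℕ) ≤ m}) := by
    ext a; simp [and_comm]
  rw [e1, e3] at h2
  rw [e2] at h3
  omega

/-- At most `h` integers lie in the window of length `h` ending at `m`, so more than `h` distinct
values cannot all fit there. -/
theorem exists_far_of_card {ι : Type*} (s : Finset ι) (f : ι → ℕ) (hf : Set.InjOn f s) (m h : ℕ)
    (hm : ∀ a ∈ s, f a ≤ m) (hs : h < s.card) : ∃ a ∈ s, h ≤ m - f a := by
  by_contra! hc
  have : s.card ≤ (Finset.Ico (m + 1 - h) (m + 1)).card := by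
    refine card_le_card_of_injOn f (fun a ha => ?_) hf
    have := hm a ha
    have := hc a ha
    simp only [coe_Ico, Set.mem_Ico]
    omega
  simp only [Nat.card_Ico] at this
  omega

/-- Distinct exponents make this a subsum of the geometric series. It bounds the price of
remembering a position by its distance to the cut. -/
theorem sum_pow_le {ι : Type*} (s : Finset ι) (f : ι → ℕ) (hf : Set.InjOn f s) {p : ℝ} (hp : 0 ≤ p)
    (hp1 : p < 1) : ∑ a ∈ s, p ^ f a ≤ (1 - p)⁻¹ := by
  classical
  rw [← sum_image (f := fun t => p ^ t) hf, ← tsum_geometric_of_lt_one hp hp1]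
  exact (summable_geometric_of_lt_one hp hp1).sum_le_tsum _ fun i _ => pow_nonneg hp i

theorem pow_min_le {p : ℝ} (hp : 0 ≤ p) (x y : ℕ) : p ^ min x y ≤ p ^ x + p ^ y := by
  have := pow_nonneg hp x
  have := pow_nonneg hp y
  rcases min_choice x y with h | h <;> rw [h] <;> linarith

theorem sum_pow_min_le {ι : Type*} (s : Finset ι) (f g : ι → ℕ) (hf : Set.InjOn f s)
    (hg : Set.InjOn g s) {p : ℝ} (hp : 0 ≤ p) (hp1 : p < 1) :
    ∑ a ∈ s, p ^ min (f a) (g a) ≤ 2 * (1 - p)⁻¹ := by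
  calc ∑ a ∈ s, p ^ min (f a) (g a) ≤ ∑ a ∈ s, (p ^ f a + p ^ g a) :=
        sum_le_sum fun a _ => pow_min_le hp _ _
    _ = ∑ a ∈ s, p ^ f a + ∑ a ∈ s, p ^ g a := sum_add_distrib
    _ ≤ _ := by linarith [sum_pow_le s f hf hp hp1, sum_pow_le s g hg hp hp1]

end Mallows

/-! ### Exponential decay of the displacement -/

namespace Mallows

open Equiv Finset

variable {n : ℕ}

theorem weight_le_of_energy {α β : ℝ} (hβ : 0 < β) {π ρ : Perm (Fin n)} {x : ℕ}
    (h : energy α ρ + x ≤ energy α π) : weight α β π ≤ weight α β ρ * Real.exp (-β) ^ x := by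
  rw [weight, weight, ← Real.exp_nat_mul, ← Real.exp_add]
  apply Real.exp_le_exp.2
  nlinarith

/-- Many arcs over a cut are unlikely, even given the value of a position before the cut. -/
theorem sum_weight_many_arcs_le {α β : ℝ} (hα : 1 ≤ α) (hβ : 0 < β) (i : Fin n)
    (Q : Fin n → Prop) [DecidablePred Q] (m : ℕ) (him : (i : ℕ) ≤ m) (h : ℕ) :
    ∑ π : Perm (Fin n) with Q (π i) ∧ h + 1 < (forwardArcs m π).card, weight α β π ≤
      (Real.exp (-β) ^ h * (2 * (1 - Real.exp (-β))⁻¹) ^ 2) *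
        ∑ π : Perm (Fin n) with Q (π i), weight α β π := by
  set p := Real.exp (-β) with hp
  have hp0 : 0 ≤ p := (Real.exp_pos _).le
  have hp1 : p < 1 := by rw [hp]; simpa using hβ
  -- After the exchange, `a` and its value lie on the left of the cut, `d` and its value on the
  -- right. The factors `gl` and `gr` are the parts of the saving that depend on `a` and on `d`,
  -- read off from the exchanged permutation. Their sums are bounded uniformly in `n`, since
  -- positions and values are each distinct.
  let gl : Perm (Fin n) → Fin n → ℝ := fun π a =>
    if (a : ℕ) ≤ m ∧ (π a : ℕ) ≤ m then p ^ min (m - a : ℕ) (m - π a) else 0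
  let gr : Perm (Fin n) → Fin n → ℝ := fun π d =>
    if m < (d : ℕ) ∧ m < (π d : ℕ) then p ^ min (π d - m : ℕ) (d - m) else 0
  have hgl : ∀ π a, 0 ≤ gl π a := fun π a => by
    simp only [gl]; split_ifs <;> positivity
  have hgr : ∀ π a, 0 ≤ gr π a := fun π a => by
    simp only [gr]; split_ifs <;> positivity
  have sl : ∀ π, ∑ a, gl π a ≤ 2 * (1 - p)⁻¹ := fun π => by
    simp only [gl]
    rw [← sum_filter]
    refine sum_pow_min_le _ _ _ ?_ ?_ hp0 hp1
    · intro a ha b hb hab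
      simp only [coe_filter, mem_univ, true_and, Set.mem_ofPred_eq] at ha hb hab
      exact Fin.ext (by omega)
    · intro a ha b hb hab
      simp only [coe_filter, mem_univ, true_and, Set.mem_ofPred_eq] at ha hb hab
      exact π.injective (Fin.ext (by omega))
  have sr : ∀ π, ∑ a, gr π a ≤ 2 * (1 - p)⁻¹ := fun π => by
    simp only [gr]
    rw [← sum_filter]
    refine sum_pow_min_le _ _ _ ?_ ?_ hp0 hp1
    · intro a ha b hb hab
      simp only [coe_filter, mem_univ, true_and, Set.mem_ofPred_eq] at ha hb hab
      exact π.injective (Fin.ext (by omega))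
    · intro a ha b hb hab
      simp only [coe_filter, mem_univ, true_and, Set.mem_ofPred_eq] at ha hb hab
      exact Fin.ext (by omega)
  refine sum_weight_le_of_swap _ _ _ (fun π => (weight_pos α β π).le)
    (fun π a d => p ^ h * (gl π a * gr π d)) (fun π a d => ?_) _ ?_ ?_
  · have := hgl π a
    have := hgr π d
    positivity
  · intro π hπ
    simp only [mem_filter, mem_univ, true_and] at hπ
    -- Excluding `i` leaves at least `h + 1` forward arcs and keeps the value of `i`, hence `Q`,
    -- unchanged; `i` is no backward arc because `i ≤ m`.
    obtain ⟨a, ha, hah⟩ := exists_far_of_card ((forwardArcs m π).erase i) (fun a => (a : ℕ))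
      (fun a _ b _ hab => Fin.ext hab) m h
      (fun a ha => by
        simp only [mem_erase, forwardArcs, mem_filter, mem_univ, true_and] at ha; exact ha.2.1)
      (by have := pred_card_le_card_erase (s := forwardArcs m π) (a := i); omega)
    obtain ⟨d, hd, hdh⟩ := exists_far_of_card (backwardArcs m π) (fun d => (π d : ℕ))
      (fun a _ b _ hab => π.injective (Fin.ext hab)) m h
      (fun a ha => by
        simp only [backwardArcs, mem_filter, mem_univ, true_and] at ha; exact ha.2)
      (by rw [card_backwardArcs]; omega)
    simp only [mem_erase, forwardArcs, mem_filter, mem_univ, true_and] at ha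
    simp only [backwardArcs, mem_filter, mem_univ, true_and] at hd
    have had : a ≠ d := by rintro rfl; omega
    have hid : i ≠ d := by rintro rfl; omega
    refine ⟨a, d, ?_, ?_⟩
    · simp only [mem_filter, mem_univ, true_and, Perm.mul_apply]
      rw [swap_apply_of_ne_of_ne ha.1.symm hid]
      exact hπ.1
    · have hE := energy_mul_swap α π had
      have hC := cost_uncross hα ha.2.1 hd.2 ha.2.2 hd.1
      set x := min (m - a : ℕ) (m - π d) with hx
      set y := min (π a - m : ℕ) (d - m) with hy
      have hhx : h ≤ x := le_min hah hdh
      -- Of the saving `2 * (x + y)`, one share `x + y` goes into `gl` and `gr`; the other is at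
      -- least `h` and gives the factor `p ^ h`.
      have h1 := weight_le_of_energy (α := α) hβ (π := π) (ρ := π * swap a d) (x := 2 * (x + y))
        (by push_cast at hC ⊢; linarith)
      refine h1.trans (mul_le_mul_of_nonneg_left ?_ (weight_pos _ _ _).le)
      simp only [gl, gr, Perm.mul_apply, swap_apply_left, swap_apply_right]
      rw [if_pos ⟨ha.2.1, hd.2⟩, if_pos ⟨hd.1, ha.2.2⟩, ← hx, ← hy, ← pow_add, ← pow_add]
      exact pow_le_pow_of_le_one hp0 hp1.le (by omega)
  · intro π _
    have : ∑ a, ∑ d, p ^ h * (gl π a * gr π d) = p ^ h * ((∑ a, gl π a) * ∑ d, gr π d) := by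
      rw [sum_mul_sum, mul_sum]
      exact sum_congr rfl fun a _ => by rw [mul_sum]
    rw [this, sq]
    refine mul_le_mul_of_nonneg_left ?_ (by positivity)
    exact mul_le_mul (sl π) (sr π) (sum_nonneg fun a _ => hgr π a)
      ((sum_nonneg fun a _ => hgl π a).trans (sl π))

/-- Among permutations with few arcs over the two cuts, a long arc can be replaced by one that
ends shortly before `j`. -/
theorem sum_weight_few_arcs_le {α β : ℝ} (hα : 1 ≤ α) (hβ : 0 < β) (i : Fin n) (h j : ℕ)
    (hj : (i : ℕ) + (2 * h + 1) ≤ j) :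
    ∑ π : Perm (Fin n) with j < (π i : ℕ) ∧ (forwardArcs i π).card ≤ h ∧
        (forwardArcs j π).card ≤ h, weight α β π ≤
      h * ∑ π : Perm (Fin n) with j - (2 * h + 1) < (π i : ℕ) ∧ (π i : ℕ) ≤ j, weight α β π := by
  classical
  set Y : Finset (Perm (Fin n)) := {π | (j - (2 * h + 1) < (π i : ℕ) ∧ (π i : ℕ) ≤ j) ∧
    (forwardArcs j π).card ≤ h} with hY
  have hYle : ∑ π ∈ Y, weight α β π ≤
      ∑ π : Perm (Fin n) with j - (2 * h + 1) < (π i : ℕ) ∧ (π i : ℕ) ≤ j, weight α β π := by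
    refine sum_le_sum_of_subset_of_nonneg ?_ fun π _ _ => (weight_pos α β π).le
    intro π hπ
    simp only [hY, mem_filter, mem_univ, true_and] at hπ ⊢
    exact hπ.1
  refine le_trans ?_ (mul_le_mul_of_nonneg_left hYle (Nat.cast_nonneg h))
  refine sum_weight_le_of_swap _ _ _ (fun π => (weight_pos α β π).le)
    -- To undo the exchange it suffices to know `l`, which has become a forward arc over `j`; in `Y`
    -- there are at most `h` of these.
    (fun π a l => if a = i ∧ l ∈ forwardArcs j π then 1 else 0)
    (fun π a l => by split_ifs <;> norm_num) _ ?_ ?_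
  · intro π hπ
    simp only [mem_filter, mem_univ, true_and] at hπ
    obtain ⟨hij, hi, hjc⟩ := hπ
    have hjn : j < n := hij.trans (π i).2
    -- The window below `j` has `2 * h + 1` values. At most `h` of them are taken beyond `j`
    -- (backward arcs over `j`) and at most `h` up to `i` (forward arcs over `i`, the window lying
    -- above `i`), so one is taken strictly after `i` and not after `j`.
    obtain ⟨l, hl1, hl2, hl3, hl4⟩ : ∃ l : Fin n, i < l ∧ (l : ℕ) ≤ j ∧
        j - (2 * h + 1) < (π l : ℕ) ∧ (π l : ℕ) ≤ j := by
      by_contra! hcon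
      have hsub : ({l : Fin n | j - (2 * h + 1) < (π l : ℕ) ∧ (π l : ℕ) ≤ j} : Finset (Fin n)) ⊆
          backwardArcs j π ∪ forwardArcs i π := by
        intro l hl
        simp only [mem_filter, mem_univ, true_and, mem_union, backwardArcs, forwardArcs] at hl ⊢
        by_cases hlj : j < (l : ℕ)
        · exact Or.inl ⟨hlj, hl.2⟩
        · right
          refine ⟨?_, by omega⟩
          by_contra hli
          have := hcon l (by rw [Fin.lt_def]; omega) (by omega) hl.1
          omega
      have h1 := (card_le_card hsub).trans (card_union_le _ _)
      rw [card_backwardArcs] at h1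
      have h2 : (Finset.Ioc (j - (2 * h + 1)) j).card ≤
          ({l : Fin n | j - (2 * h + 1) < (π l : ℕ) ∧ (π l : ℕ) ≤ j} : Finset (Fin n)).card := by
        refine card_le_card_of_surjOn (fun l => (π l : ℕ)) ?_
        intro c hc
        simp only [coe_Ioc, Set.mem_Ioc] at hc
        refine ⟨π.symm ⟨c, by omega⟩, ?_, by simp⟩
        simpa using hc
      rw [Nat.card_Ioc] at h2
      omega
    have hil : i ≠ l := hl1.ne
    refine ⟨i, l, ?_, ?_⟩
    · simp only [hY, mem_filter, mem_univ, true_and, Perm.mul_apply, swap_apply_left]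
      refine ⟨⟨hl3, hl4⟩, le_trans ?_ hjc⟩
      -- The arc from `i` stops crossing `j` and the one from `l` starts to, so the number of
      -- crossings does not grow.
      have hsub : forwardArcs j (π * swap i l) ⊆ insert l ((forwardArcs j π).erase i) := by
        intro a ha
        simp only [mem_forwardArcs, mem_insert, mem_erase] at ha ⊢
        rw [Perm.mul_apply] at ha
        by_cases hal : a = l
        · exact Or.inl hal
        · right
          have hai : a ≠ i := by
            rintro rfl
            rw [swap_apply_left] at ha
            omega
          rw [swap_apply_of_ne_of_ne hai hal] at ha
          exact ⟨hai, ha⟩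
      have himem : i ∈ forwardArcs j π := by
        simp only [forwardArcs, mem_filter, mem_univ, true_and]
        omega
      have h1 := (card_le_card hsub).trans (card_insert_le _ _)
      have h2 := card_erase_add_one himem
      omega
    · rw [if_pos]
      · rw [mul_one]
        have hE := energy_mul_swap α π hil
        have hM := cost_monge hα (a := i) (a' := l) (b := π l) (b' := π i)
          (by rw [Fin.lt_def] at hl1; omega) (by omega)
        have := weight_le_of_energy (α := α) hβ (π := π) (ρ := π * swap i l) (x := 0)
          (by push_cast; linarith)
        simpa using this
      · rw [mem_forwardArcs, Perm.mul_apply, swap_apply_right]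
        exact ⟨rfl, hl2, hij⟩
  · intro π hπ
    simp only [hY, mem_filter, mem_univ, true_and] at hπ
    rw [sum_eq_single i]
    · simp only [true_and]
      rw [← sum_filter]
      simp only [filter_univ_mem, sum_const, nsmul_eq_mul, mul_one]
      exact_mod_cast hπ.2
    · intro a _ ha
      simp [ha]
    · simp

/-- The total weight of the permutations that move `i` beyond `j`. -/
noncomputable def tailWeight (α β : ℝ) (i : Fin n) (j : ℕ) : ℝ :=
  ∑ π : Perm (Fin n) with j < (π i : ℕ), weight α β π

theorem tailWeight_nonneg (α β : ℝ) (i : Fin n) (j : ℕ) : 0 ≤ tailWeight α β i j :=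
  sum_nonneg fun π _ => (weight_pos α β π).le

/-- Write `T j` for the tail and `L` for the window length. Many arcs over `i` or over `j` account
for at most `T j / 4` each, and the rest is at most `h + 1` times the window weight `T (j - L) - T
j`. Solving for `T j` gives the contraction factor. -/
theorem tailWeight_contract {α β : ℝ} (hα : 1 ≤ α) (hβ : 0 < β) {h : ℕ}
    (hh : Real.exp (-β) ^ h * (2 * (1 - Real.exp (-β))⁻¹) ^ 2 ≤ 1 / 4) (i : Fin n) (j : ℕ)
    (hj : (i : ℕ) + (2 * (h + 1) + 1) ≤ j) :
    tailWeight α β i j ≤ ((h + 1) / (h + 1 + 1 / 2) : ℝ) * tailWeight α β i (j - (2 * (h + 1) + 1)) := by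
  classical
  have hw : ∀ π : Perm (Fin n), 0 ≤ weight α β π := fun π => (weight_pos α β π).le
  have h0 := tailWeight_nonneg α β i j
  have A := sum_weight_many_arcs_le hα hβ i (fun c => j < (c : ℕ)) i le_rfl h
  have B := sum_weight_many_arcs_le hα hβ i (fun c => j < (c : ℕ)) j (by omega) h
  have C := sum_weight_few_arcs_le hα hβ i (h + 1) j hj
  have D : tailWeight α β i (j - (2 * (h + 1) + 1)) = tailWeight α β i j +
      ∑ π : Perm (Fin n) with j - (2 * (h + 1) + 1) < (π i : ℕ) ∧ (π i : ℕ) ≤ j, weight α β π := by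
    unfold tailWeight
    rw [← sum_filter_add_sum_filter_not _ (fun π : Perm (Fin n) => j < (π i : ℕ)), filter_filter,
      filter_filter]
    congr 1
    · refine sum_congr (filter_congr fun π _ => ?_) fun _ _ => rfl
      omega
    · refine sum_congr (filter_congr fun π _ => ?_) fun _ _ => rfl
      omega
  have E : tailWeight α β i j ≤
      ∑ π : Perm (Fin n) with j < (π i : ℕ) ∧ h + 1 < (forwardArcs i π).card, weight α β π +
      ∑ π : Perm (Fin n) with j < (π i : ℕ) ∧ h + 1 < (forwardArcs j π).card, weight α β π +
      ∑ π : Perm (Fin n) with j < (π i : ℕ) ∧ (forwardArcs i π).card ≤ h + 1 ∧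
        (forwardArcs j π).card ≤ h + 1, weight α β π := by
    unfold tailWeight
    simp only [sum_filter]
    rw [← sum_add_distrib, ← sum_add_distrib]
    refine sum_le_sum fun π _ => ?_
    have := hw π
    split_ifs <;> first | linarith | omega
  have F : tailWeight α β i j = ∑ π : Perm (Fin n) with j < (π i : ℕ), weight α β π := rfl
  rw [← F] at A B
  have A' := A.trans (mul_le_mul_of_nonneg_right hh h0)
  have B' := B.trans (mul_le_mul_of_nonneg_right hh h0)
  rw [div_mul_eq_mul_div, le_div_iff₀ (by positivity)]
  push_cast at C
  rw [D, mul_add]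
  nlinarith

/-- Exponential decay of the displacement: for each `t`, each position is moved to the right by
more than `K * t` with probability at most `2 ^ (-t)`. -/
theorem exists_tailWeight_le {α β : ℝ} (hα : 1 ≤ α) (hβ : 0 < β) :
    ∃ K : ℕ, ∀ (n : ℕ) (i : Fin n) (t : ℕ),
      tailWeight α β i (i + K * t) ≤ (1 / 2) ^ t * ∑ π : Perm (Fin n), weight α β π := by
  have hp0 : 0 ≤ Real.exp (-β) := (Real.exp_pos _).le
  have hp1 : Real.exp (-β) < 1 := by simpa using hβ
  obtain ⟨h, hh⟩ : ∃ h : ℕ, Real.exp (-β) ^ h * (2 * (1 - Real.exp (-β))⁻¹) ^ 2 ≤ 1 / 4 := by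
    have := (tendsto_pow_atTop_nhds_zero_of_lt_one hp0 hp1).mul_const
      ((2 * (1 - Real.exp (-β))⁻¹) ^ 2)
    rw [zero_mul] at this
    exact (this.eventually_le_const (show (0 : ℝ) < 1 / 4 by norm_num)).exists
  set ρ : ℝ := (h + 1) / (h + 1 + 1 / 2) with hρ
  have hρ0 : 0 ≤ ρ := by positivity
  have hρ1 : ρ < 1 := by rw [hρ, div_lt_one (by positivity)]; linarith
  -- `s` contractions halve the tail, so `K` is `s` window lengths.
  obtain ⟨s, hs⟩ := exists_pow_lt_of_lt_one (show (0 : ℝ) < 1 / 2 by norm_num) hρ1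
  refine ⟨(2 * (h + 1) + 1) * s, fun n i t => ?_⟩
  have key : ∀ u : ℕ, tailWeight α β i (i + (2 * (h + 1) + 1) * u) ≤
      ρ ^ u * ∑ π : Perm (Fin n), weight α β π := by
    intro u
    induction u with
    | zero =>
      rw [pow_zero, one_mul]
      exact sum_le_sum_of_subset_of_nonneg (filter_subset _ _) fun π _ _ => (weight_pos α β π).le
    | succ u ih =>
      have h1 := tailWeight_contract hα hβ hh i (i + (2 * (h + 1) + 1) * (u + 1))
        (Nat.add_le_add_left (Nat.le_mul_of_pos_right _ u.succ_pos) _)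
      rw [show (i : ℕ) + (2 * (h + 1) + 1) * (u + 1) - (2 * (h + 1) + 1) =
        i + (2 * (h + 1) + 1) * u by rw [Nat.mul_succ _ u]; omega] at h1
      rw [pow_succ', mul_assoc]
      exact h1.trans (mul_le_mul_of_nonneg_left ih hρ0)
  rw [mul_assoc]
  refine (key (s * t)).trans (mul_le_mul_of_nonneg_right ?_
    (sum_nonneg fun π _ => (weight_pos α β π).le))
  rw [pow_mul]
  exact pow_le_pow_left₀ (by positivity) hs.le t

end Mallows

/-! ### Truncation to a band: permanent and total variation -/

namespace Mallows

open Equiv Finset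

variable {n : ℕ}

/-- No position is moved by more than `k`. -/
def InBand (k : ℕ) (π : Perm (Fin n)) : Prop := ∀ i : Fin n, (i : ℕ) ≤ π i + k ∧ (π i : ℕ) ≤ i + k

instance (k : ℕ) (π : Perm (Fin n)) : Decidable (InBand k π) := by
  unfold InBand; infer_instance

theorem cost_comm (α : ℝ) (a b : ℕ) : cost α a b = cost α b a := by
  rw [cost, cost, abs_sub_comm]

theorem inv_apply_apply (π : Perm (Fin n)) (i : Fin n) : π⁻¹ (π i) = i :=
  π.symm_apply_apply i

theorem weight_inv (α β : ℝ) (π : Perm (Fin n)) : weight α β π⁻¹ = weight α β π := by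
  unfold weight energy
  rw [← Equiv.sum_comp π]
  simp only [inv_apply_apply]
  congr 2
  exact sum_congr rfl fun i _ => cost_comm _ _ _

theorem sum_weight_inv_tail (α β : ℝ) (i : Fin n) (j : ℕ) :
    ∑ π : Perm (Fin n) with j < (π⁻¹ i : ℕ), weight α β π = tailWeight α β i j := by
  unfold tailWeight
  rw [sum_filter, sum_filter, ← Equiv.sum_comp (Equiv.inv (Perm (Fin n)))]
  refine sum_congr rfl fun π _ => ?_
  simp [weight_inv]

/-- Union bound over the `n` positions and the two directions. A move of `i` to the left under `π`
is a move of `π i` to the right under `π⁻¹`, and inversion preserves the weight. -/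
theorem exists_sum_weight_not_inBand_le {α β : ℝ} (hα : 1 ≤ α) (hβ : 0 < β) :
    ∃ K : ℕ, ∀ n t : ℕ, ∑ π : Perm (Fin n) with ¬ InBand (K * t) π, weight α β π ≤
      2 * n * (1 / 2) ^ t * ∑ π : Perm (Fin n), weight α β π := by
  obtain ⟨K, hK⟩ := exists_tailWeight_le hα hβ
  refine ⟨K, fun n t => ?_⟩
  have hw : ∀ π : Perm (Fin n), 0 ≤ weight α β π := fun π => (weight_pos α β π).le
  have h1 : ∑ π : Perm (Fin n) with ¬ InBand (K * t) π, weight α β π ≤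
      ∑ i : Fin n, (∑ π : Perm (Fin n) with (i : ℕ) + K * t < (π i : ℕ), weight α β π +
        ∑ π : Perm (Fin n) with (i : ℕ) + K * t < (π⁻¹ i : ℕ), weight α β π) := by
    simp only [sum_filter, ← sum_add_distrib]
    rw [sum_comm]
    refine sum_le_sum fun π _ => ?_
    have hterm : ∀ i : Fin n, 0 ≤ (if (i : ℕ) + K * t < (π i : ℕ) then weight α β π else 0) +
        (if (i : ℕ) + K * t < (π⁻¹ i : ℕ) then weight α β π else 0) := fun i => by
      have := hw π
      split_ifs <;> linarith
    by_cases hb : InBand (K * t) π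
    · rw [if_neg (not_not.2 hb)]
      exact sum_nonneg fun i _ => hterm i
    · rw [if_pos hb]
      simp only [InBand, not_forall] at hb
      obtain ⟨i, hi⟩ := hb
      have := hw π
      by_cases hi2 : (i : ℕ) + K * t < (π i : ℕ)
      · refine le_trans ?_ (single_le_sum (fun i _ => hterm i) (mem_univ i))
        rw [if_pos hi2]
        split_ifs <;> linarith
      · refine le_trans ?_ (single_le_sum (fun i _ => hterm i) (mem_univ (π i)))
        rw [if_pos (show ((π i : Fin n) : ℕ) + K * t < (π⁻¹ (π i) : ℕ) by
          rw [inv_apply_apply]; omega)]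
        split_ifs <;> linarith
  refine h1.trans ?_
  calc _ ≤ ∑ i : Fin n, 2 * ((1 / 2) ^ t * ∑ π : Perm (Fin n), weight α β π) := by
        refine sum_le_sum fun i _ => ?_
        rw [sum_weight_inv_tail]
        have := hK n i t
        change tailWeight α β i _ + _ ≤ _
        linarith
    _ = _ := by simp; ring

theorem sum_weight_pos (n : ℕ) (α β : ℝ) : 0 < ∑ π : Perm (Fin n), weight α β π :=
  sum_pos (fun π _ => weight_pos α β π) univ_nonempty

theorem bandMatrix_apply (α β : ℝ) (k : ℕ) (i j : Fin n) :
    bandMatrix n α β k i j =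
      if (i : ℕ) ≤ j + k ∧ (j : ℕ) ≤ i + k then Real.exp (-β * cost α i j) else 0 := by
  unfold bandMatrix cost
  refine if_congr ?_ rfl rfl
  rw [abs_sub_le_iff, sub_le_iff_le_add', sub_le_iff_le_add']
  norm_cast

theorem prod_bandMatrix (α β : ℝ) (k : ℕ) (π : Perm (Fin n)) :
    ∏ i, bandMatrix n α β k i (π i) = if InBand k π then weight α β π else 0 := by
  simp only [bandMatrix_apply]
  split_ifs with h
  · rw [prod_congr rfl fun i _ => if_pos (h i), ← Real.exp_sum, weight, energy, mul_sum]
  · simp only [InBand, not_forall] at h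
    obtain ⟨i, hi⟩ := h
    exact prod_eq_zero (mem_univ i) (if_neg hi)

/-- Reindexing the rows by `σ` turns the central ranking into the identity, with `π * σ⁻¹` in place
of `π`. -/
theorem prod_bandMatrix_center (α β : ℝ) (k : ℕ) (σ π : Perm (Fin n)) :
    ∏ i, bandMatrix n α β k (σ i) (π i) =
      if InBand k (π * σ⁻¹) then weight α β (π * σ⁻¹) else 0 := by
  rw [← prod_bandMatrix, ← Equiv.prod_comp σ (fun i => bandMatrix n α β k i ((π * σ⁻¹) i))]
  simp

theorem exp_dist (α β : ℝ) (π σ : Perm (Fin n)) :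
    Real.exp (-β * dist α π σ) = weight α β (π * σ⁻¹) := by
  rw [weight, energy, ← Equiv.sum_comp σ]
  simp only [dist, cost, Perm.mul_apply, inv_apply_apply]
  congr 2
  exact sum_congr rfl fun i _ => by rw [abs_sub_comm]

theorem bandMatrix_comm (α β : ℝ) (k : ℕ) (i j : Fin n) :
    bandMatrix n α β k i j = bandMatrix n α β k j i := by
  rw [bandMatrix_apply, bandMatrix_apply, cost_comm]
  simp only [and_comm]

theorem permanent_bandMatrix (n : ℕ) (α β : ℝ) (k : ℕ) :
    (bandMatrix n α β k).permanent = ∑ π : Perm (Fin n) with InBand k π, weight α β π := by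
  rw [Matrix.permanent, sum_filter]
  refine sum_congr rfl fun π _ => ?_
  rw [← prod_bandMatrix]
  -- `Matrix.permanent` has the permuted index in the row, which is immaterial for a symmetric
  -- matrix.
  exact prod_congr rfl fun i _ => bandMatrix_comm _ _ _ _ _

theorem partitionFunction_eq (α β : ℝ) (σ : Perm (Fin n)) :
    partitionFunction α β σ = ∑ π : Perm (Fin n), weight α β π := by
  unfold partitionFunction
  simp only [exp_dist]
  exact Equiv.sum_comp (Equiv.mulRight σ⁻¹) (weight α β)

theorem sum_inBand_center (α β : ℝ) (k : ℕ) (σ : Perm (Fin n)) :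
    ∑ π : Perm (Fin n), (if InBand k (π * σ⁻¹) then weight α β (π * σ⁻¹) else 0) =
      (bandMatrix n α β k).permanent := by
  rw [permanent_bandMatrix, sum_filter]
  exact Equiv.sum_comp (Equiv.mulRight σ⁻¹) (fun π => if InBand k π then weight α β π else 0)

theorem permanent_bandMatrix_pos (n : ℕ) (α β : ℝ) (k : ℕ) :
    0 < (bandMatrix n α β k).permanent := by
  rw [permanent_bandMatrix]
  refine sum_pos (fun π _ => weight_pos α β π) ⟨1, ?_⟩
  exact mem_filter.2 ⟨mem_univ _, fun i => by simp⟩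

theorem permanent_bandMatrix_le (α β : ℝ) (k : ℕ) (σ : Perm (Fin n)) :
    (bandMatrix n α β k).permanent ≤ partitionFunction α β σ := by
  rw [permanent_bandMatrix, partitionFunction_eq]
  exact sum_le_sum_of_subset_of_nonneg (filter_subset _ _) fun π _ _ => (weight_pos α β π).le

theorem le_permanent_bandMatrix {α β δ : ℝ} {k : ℕ} (σ : Perm (Fin n))
    (h : ∑ π : Perm (Fin n) with ¬ InBand k π, weight α β π ≤
      δ * ∑ π : Perm (Fin n), weight α β π) :
    (1 - δ) * partitionFunction α β σ ≤ (bandMatrix n α β k).permanent := by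
  rw [permanent_bandMatrix, partitionFunction_eq]
  have := sum_filter_add_sum_filter_not univ (fun π : Perm (Fin n) => InBand k π) (weight α β)
  linarith

theorem proportionalTo_apply {Ω : Type*} [Fintype Ω] (w : Ω → ℝ) (h : ∃ a, 0 < w a)
    (hw : ∀ a, 0 ≤ w a) (a : Ω) :
    proportionalTo w h a = ENNReal.ofReal (w a / ∑ b, w b) := by
  have hs : 0 < ∑ b, w b := by
    obtain ⟨b, hb⟩ := h
    exact sum_pos' (fun a _ => hw a) ⟨b, mem_univ b, hb⟩
  rw [proportionalTo, PMF.normalize_apply, tsum_fintype,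
    ← ENNReal.ofReal_sum_of_nonneg fun a _ => hw a, ENNReal.ofReal_div_of_pos hs, div_eq_mul_inv]

theorem proportionalTo_apply_toReal {Ω : Type*} [Fintype Ω] (w : Ω → ℝ) (h : ∃ a, 0 < w a)
    (hw : ∀ a, 0 ≤ w a) (a : Ω) :
    (proportionalTo w h a).toReal = w a / ∑ b, w b := by
  rw [proportionalTo_apply w h hw,
    ENNReal.toReal_ofReal (div_nonneg (hw a) (sum_nonneg fun b _ => hw b))]

/-- Restricting a distribution to an event changes it, in total variation, by the probability of
the complement. -/
theorem tvDist_proportionalTo_restrict {Ω : Type*} [Fintype Ω] (w : Ω → ℝ) (E : Ω → Prop)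
    [DecidablePred E] (hw : ∀ a, 0 ≤ w a) (h : ∃ a, 0 < w a)
    (hE : ∃ a, 0 < if E a then w a else 0) :
    tvDist (proportionalTo (fun a => if E a then w a else 0) hE) (proportionalTo w h) =
      1 - (∑ a, if E a then w a else 0) / ∑ a, w a := by
  have hwE : ∀ a, 0 ≤ if E a then w a else 0 := fun a => by
    have := hw a
    split_ifs <;> linarith
  have hZ : 0 < ∑ a, w a := by
    obtain ⟨b, hb⟩ := h
    exact sum_pos' (fun a _ => hw a) ⟨b, mem_univ b, hb⟩
  have hZE : 0 < ∑ a, if E a then w a else 0 := by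
    obtain ⟨b, hb⟩ := hE
    exact sum_pos' (fun a _ => hwE a) ⟨b, mem_univ b, hb⟩
  have hle : (∑ a, if E a then w a else 0) ≤ ∑ a, w a := sum_le_sum fun a _ => by
    have := hw a
    split_ifs <;> linarith
  unfold tvDist
  simp only [proportionalTo_apply_toReal _ _ hw, proportionalTo_apply_toReal _ _ hwE]
  set Z := ∑ a, w a
  set Y := ∑ a, if E a then w a else 0 with hY
  -- Restriction raises the probabilities inside `E`, since `Y ≤ Z`, and kills those outside. The
  -- right-hand side covers both cases by an expression linear in the two weights, so that it can be
  -- summed.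
  have hpt : ∀ a, |(if E a then w a else 0) / Y - w a / Z| =
      (if E a then w a else 0) * (Y⁻¹ - 2 * Z⁻¹) + w a * Z⁻¹ := by
    intro a
    have hinv : Z⁻¹ ≤ Y⁻¹ := inv_anti₀ hZE hle
    have h0 : 0 ≤ Z⁻¹ := inv_nonneg.2 hZ.le
    have h1 := hw a
    rw [div_eq_mul_inv, div_eq_mul_inv]
    split_ifs
    · rw [← mul_sub, abs_of_nonneg (mul_nonneg h1 (by linarith))]
      ring
    · rw [zero_mul, zero_sub, abs_neg, abs_of_nonneg (mul_nonneg h1 h0)]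
      ring
  rw [sum_congr rfl fun a _ => hpt a, sum_add_distrib, ← sum_mul, ← sum_mul, ← hY]
  change 1 / 2 * (Y * (Y⁻¹ - 2 * Z⁻¹) + Z * Z⁻¹) = _
  field_simp
  ring

theorem tvDist_truncatedMallows_le {α β δ : ℝ} {k : ℕ} (σ : Perm (Fin n))
    (h : ∑ π : Perm (Fin n) with ¬ InBand k π, weight α β π ≤
      δ * ∑ π : Perm (Fin n), weight α β π) :
    tvDist (truncatedMallows α β k σ) (mallows α β σ) ≤ δ := by
  have e : truncatedMallows α β k σ = proportionalTo
      (fun π => if InBand k (π * σ⁻¹) then Real.exp (-β * dist α π σ) else 0)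
      ⟨σ, by simp [InBand, Real.exp_pos]⟩ := by
    unfold truncatedMallows
    congr 1
    funext π
    rw [prod_bandMatrix_center, exp_dist]
  rw [e, mallows, tvDist_proportionalTo_restrict _ _ fun π => (Real.exp_pos _).le]
  simp only [exp_dist, sum_inBand_center]
  have h1 := le_permanent_bandMatrix σ h
  have h2 := partitionFunction_eq α β σ
  have hZ := sum_weight_pos n α β
  rw [← h2] at hZ
  rw [show ∑ π, weight α β (π * σ⁻¹) = partitionFunction α β σ by
    simp only [partitionFunction, exp_dist]]
  have := (le_div_iff₀ hZ).2 h1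
  linarith

theorem truncatedMallows_apply (α β : ℝ) (k : ℕ) (σ π : Perm (Fin n)) :
    truncatedMallows α β k σ π = ENNReal.ofReal
      ((∏ i, bandMatrix n α β k i ((π * σ⁻¹) i)) / (bandMatrix n α β k).permanent) := by
  rw [truncatedMallows, proportionalTo_apply]
  · simp only [prod_bandMatrix_center, sum_inBand_center, prod_bandMatrix]
  · intro π
    rw [prod_bandMatrix_center]
    have := (weight_pos α β (π * σ⁻¹)).le
    split_ifs <;> linarith

end Mallows

/-! ### A program logic with couplings and step counts -/

namespace RealRAM

theorem bind_congr_support {A B : Type*} (p : PMF A) {f g : A → PMF B}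
    (h : ∀ a ∈ p.support, f a = g a) : p.bind f = p.bind g := by
  ext b
  rw [PMF.bind_apply, PMF.bind_apply]
  refine tsum_congr fun a => ?_
  by_cases ha : a ∈ p.support
  · rw [h a ha]
  · rw [(PMF.apply_eq_zero_iff p a).2 ha, zero_mul, zero_mul]

/-- Started on `s`, the program `p` halts within `t` steps, and its final memory can be coupled with
a random variable of distribution `μ` such that the two are related by `Q`. The last component of
the coupling is the number of unused steps. -/
def Triple {Ω : Type} (p : Prog) (s : State) (t : ℕ) (μ : PMF Ω) (Q : Ω → State → Prop) : Prop :=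
  ∃ ξ : PMF (Ω × State × ℕ), ξ.map Prod.fst = μ ∧ (∀ x ∈ ξ.support, Q x.1 x.2.1) ∧
    ∀ (r : List Prog) (N : ℕ),
      run (t + N) (p :: r, s) = ξ.bind fun x => run (x.2.2 + N) (r, x.2.1)

variable {Ω Ω' : Type} {p q : Prog} {s : State} {t : ℕ} {μ : PMF Ω} {Q : Ω → State → Prop}

theorem run_nil (T : ℕ) (s : State) : run T ([], s) = PMF.pure ([], s) := by
  induction T with
  | zero => rfl
  | succ T ih => rw [run, step, PMF.pure_bind, ih]

/-- With nothing left on the stack the machine idles, so the unused steps recorded by the coupling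
have no effect. -/
theorem Triple.run_eq (h : Triple p s t μ Q) : ∃ ξ : PMF (Ω × State × ℕ), ξ.map Prod.fst = μ ∧
    (∀ x ∈ ξ.support, Q x.1 x.2.1) ∧ run t ([p], s) = ξ.map fun x => ([], x.2.1) := by
  obtain ⟨ξ, h1, h2, h3⟩ := h
  refine ⟨ξ, h1, h2, ?_⟩
  have := h3 [] 0
  rw [add_zero] at this
  rw [this]
  simp only [run_nil]
  rfl

theorem Triple.haltsWithin (h : Triple p s t μ Q) : p.HaltsWithin s t := by
  obtain ⟨ξ, _, _, h3⟩ := h.run_eq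
  intro c hc
  rw [h3, PMF.mem_support_map_iff] at hc
  obtain ⟨x, _, rfl⟩ := hc
  rfl

theorem Triple.map_memoryAfter (h : Triple p s t μ Q) {A : Type} {f : State → A} {g : Ω → A}
    (hQ : ∀ ω s', Q ω s' → f s' = g ω) : (p.memoryAfter s t).map f = μ.map g := by
  obtain ⟨ξ, h1, h2, h3⟩ := h.run_eq
  rw [Prog.memoryAfter, h3, PMF.map_comp, PMF.map_comp, ← h1, PMF.map_comp]
  refine bind_congr_support ξ fun x hx => ?_
  simp only [Function.comp_apply]
  rw [hQ _ _ (h2 x hx)]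

theorem Triple.mono (h : Triple p s t μ Q) {t' : ℕ} (ht : t ≤ t') {Q' : Ω → State → Prop}
    (hQ : ∀ ω s', Q ω s' → Q' ω s') : Triple p s t' μ Q' := by
  obtain ⟨ξ, h1, h2, h3⟩ := h
  refine ⟨ξ.map fun x => (x.1, x.2.1, x.2.2 + (t' - t)), ?_, ?_, fun r N => ?_⟩
  · rw [PMF.map_comp, ← h1]; rfl
  · intro x hx
    rw [PMF.mem_support_map_iff] at hx
    obtain ⟨y, hy, rfl⟩ := hx
    exact hQ _ _ (h2 y hy)
  · rw [PMF.bind_map, show t' + N = t + (t' - t + N) by omega, h3]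
    congr 1
    funext x
    simp only [Function.comp_apply]
    rw [add_assoc]

theorem Triple.of_step (s' : State) (h : ∀ r, step (p :: r, s) = PMF.pure (r, s')) (ω : Ω)
    (hQ : Q ω s') : Triple p s 1 (PMF.pure ω) Q := by
  refine ⟨PMF.pure (ω, s', 0), PMF.pure_map _ _, ?_, fun r N => ?_⟩
  · intro x hx
    rw [PMF.mem_support_pure_iff] at hx
    rw [hx]
    exact hQ
  · rw [add_comm, run, h, PMF.pure_bind, PMF.pure_bind, zero_add]

theorem Triple.skip (ω : Ω) (hQ : Q ω s) : Triple .skip s 1 (PMF.pure ω) Q :=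
  .of_step s (fun _ => rfl) ω hQ

theorem Triple.setNat (ω : Ω) {a : ℕ} {i x : NExpr}
    (hQ : Q ω (s.setNat a (i.eval s) (x.eval s))) :
    Triple (.setNat a i x) s 1 (PMF.pure ω) Q :=
  .of_step _ (fun _ => rfl) ω hQ

theorem Triple.setReal (ω : Ω) {a : ℕ} {i : NExpr} {x : RExpr}
    (hQ : Q ω (s.setReal a (i.eval s) (x.eval s))) :
    Triple (.setReal a i x) s 1 (PMF.pure ω) Q :=
  .of_step _ (fun _ => rfl) ω hQ

/-- A program that turns into another one in one step. -/
theorem Triple.of_step_to {p' : Prog} {s' : State}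
    (hs : ∀ r, step (p :: r, s) = PMF.pure (p' :: r, s'))
    (h : Triple p' s' t μ Q) : Triple p s (t + 1) μ Q := by
  obtain ⟨ξ, h1, h2, h3⟩ := h
  refine ⟨ξ, h1, h2, fun r N => ?_⟩
  rw [show t + 1 + N = t + N + 1 by omega, run, hs, PMF.pure_bind, h3]

/-- Execution of `p` and then of `q`, without the step that takes a sequence apart. -/
theorem bind_run {t₁ t₂ : ℕ} {κ : Ω → PMF Ω'} {R : Ω' → State → Prop}
    (h₁ : Triple p s t₁ μ Q) (h₂ : ∀ ω s', Q ω s' → Triple q s' t₂ (κ ω) R) :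
    ∃ ξ : PMF (Ω' × State × ℕ), ξ.map Prod.fst = μ.bind κ ∧ (∀ x ∈ ξ.support, R x.1 x.2.1) ∧
      ∀ (r : List Prog) (N : ℕ),
        run (t₁ + t₂ + N) (p :: q :: r, s) = ξ.bind fun x => run (x.2.2 + N) (r, x.2.1) := by
  classical
  obtain ⟨ξ, h1, h2, h3⟩ := h₁
  have key : ∀ x : Ω × State × ℕ, ∃ ζ : PMF (Ω' × State × ℕ), ζ.map Prod.fst = κ x.1 ∧
      (x ∈ ξ.support → (∀ y ∈ ζ.support, R y.1 y.2.1) ∧ ∀ (r : List Prog) (N : ℕ),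
        run (t₂ + N) (q :: r, x.2.1) = ζ.bind fun y => run (y.2.2 + N) (r, y.2.1)) := by
    intro x
    by_cases hx : x ∈ ξ.support
    · obtain ⟨ζ, e1, e2, e3⟩ := h₂ _ _ (h2 x hx)
      exact ⟨ζ, e1, fun _ => ⟨e2, e3⟩⟩
    -- Unreachable outcomes need no run behind them, only a distribution with the right marginal.
    · refine ⟨(κ x.1).map fun ω => (ω, s, 0), ?_, fun h => absurd h hx⟩
      rw [PMF.map_comp]
      exact PMF.map_id _
  choose ζ hζ1 hζ2 using key
  refine ⟨ξ.bind fun x => (ζ x).map fun y => (y.1, y.2.1, y.2.2 + x.2.2), ?_, ?_, fun r N => ?_⟩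
  · rw [PMF.map_bind, ← h1, PMF.bind_map]
    congr 1
    funext x
    rw [PMF.map_comp]
    exact hζ1 x
  · intro y hy
    rw [PMF.mem_support_bind_iff] at hy
    obtain ⟨x, hx, hy⟩ := hy
    rw [PMF.mem_support_map_iff] at hy
    obtain ⟨z, hz, rfl⟩ := hy
    exact (hζ2 x hx).1 z hz
  · rw [add_assoc, h3, PMF.bind_bind]
    refine bind_congr_support ξ fun x hx => ?_
    rw [show x.2.2 + (t₂ + N) = t₂ + (x.2.2 + N) by omega, (hζ2 x hx).2, PMF.bind_map]
    congr 1
    funext y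
    simp only [Function.comp_apply]
    rw [add_assoc]

theorem Triple.seq {t₁ t₂ : ℕ} {κ : Ω → PMF Ω'} {R : Ω' → State → Prop}
    (h₁ : Triple p s t₁ μ Q) (h₂ : ∀ ω s', Q ω s' → Triple q s' t₂ (κ ω) R) :
    Triple (.seq p q) s (t₁ + t₂ + 1) (μ.bind κ) R := by
  obtain ⟨ξ, h1, h2, h3⟩ := bind_run h₁ h₂
  refine ⟨ξ, h1, h2, fun r N => ?_⟩
  rw [show t₁ + t₂ + 1 + N = t₁ + t₂ + N + 1 by omega, run, step, PMF.pure_bind, h3]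

/-- Sequencing after a deterministic program. -/
theorem Triple.seq_pure {t₁ t₂ : ℕ} {ω : Ω} {μ' : PMF Ω'} {R : Ω' → State → Prop}
    (h₁ : Triple p s t₁ (PMF.pure ω) Q) (h₂ : ∀ s', Q ω s' → Triple q s' t₂ μ' R) :
    Triple (.seq p q) s (t₁ + t₂ + 1) μ' R := by
  -- A point mass as marginal forces the first component of every outcome in the support to be `ω`.
  have h₁' : Triple p s t₁ (PMF.pure ω) (fun ω' s' => ω' = ω ∧ Q ω s') := by
    obtain ⟨ξ, h1, h2, h3⟩ := h₁
    refine ⟨ξ, h1, fun x hx => ?_, h3⟩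
    have hx1 : x.1 ∈ (ξ.map Prod.fst).support := (PMF.mem_support_map_iff _ _ _).2 ⟨x, hx, rfl⟩
    rw [h1, PMF.mem_support_pure_iff] at hx1
    exact ⟨hx1, hx1 ▸ h2 x hx⟩
  have := h₁'.seq (κ := fun _ => μ') (R := R) fun ω' s' h => h₂ s' h.2
  rwa [PMF.pure_bind] at this

theorem Triple.setNat_seq {a : ℕ} {i x : NExpr}
    (h : Triple q (s.setNat a (i.eval s) (x.eval s)) t μ Q) :
    Triple (.seq (.setNat a i x) q) s (t + 2) μ Q := by
  have := Triple.seq_pure (Triple.setNat (Q := fun (_ : Unit) s' =>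
    s' = s.setNat a (i.eval s) (x.eval s)) () rfl) (fun s' hs' => hs' ▸ h)
  exact this.mono (by omega) fun _ _ h => h

theorem Triple.setReal_seq {a : ℕ} {i : NExpr} {x : RExpr}
    (h : Triple q (s.setReal a (i.eval s) (x.eval s)) t μ Q) :
    Triple (.seq (.setReal a i x) q) s (t + 2) μ Q := by
  have := Triple.seq_pure (Triple.setReal (Q := fun (_ : Unit) s' =>
    s' = s.setReal a (i.eval s) (x.eval s)) () rfl) (fun s' hs' => hs' ▸ h)
  exact this.mono (by omega) fun _ _ h => h

theorem Triple.ite_true {b : Test} (hb : b.holds s) (h : Triple p s t μ Q) :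
    Triple (.ite b p q) s (t + 1) μ Q :=
  .of_step_to (fun r => by rw [step, if_pos hb]) h

theorem Triple.ite_false {b : Test} (hb : ¬ b.holds s) (h : Triple q s t μ Q) :
    Triple (.ite b p q) s (t + 1) μ Q :=
  .of_step_to (fun r => by rw [step, if_neg hb]) h

theorem Triple.flip {x : RExpr} {κ : Bool → PMF Ω} (h₁ : Triple p s t (κ true) Q)
    (h₂ : Triple q s t (κ false) Q) :
    Triple (.flip x p q) s (t + 1) ((coin (x.eval s)).bind κ) Q := by
  obtain ⟨ξ, h1, h2, h3⟩ := h₁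
  obtain ⟨ζ, e1, e2, e3⟩ := h₂
  refine ⟨(coin (x.eval s)).bind fun b => if b then ξ else ζ, ?_, ?_, fun r N => ?_⟩
  · rw [PMF.map_bind]
    congr 1
    funext b
    cases b
    · simpa using e1
    · simpa using h1
  · intro y hy
    rw [PMF.mem_support_bind_iff] at hy
    obtain ⟨b, _, hy⟩ := hy
    cases b
    · exact e2 y (by simpa using hy)
    · exact h2 y (by simpa using hy)
  · rw [show t + 1 + N = t + N + 1 by omega, run, step, PMF.bind_bind, PMF.bind_bind]
    congr 1
    funext b
    rw [PMF.pure_bind]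
    cases b
    · simpa using e3 r N
    · simpa using h3 r N

/-- `l` steps of a Markov chain, from time `j` on. -/
noncomputable def chain (κ : ℕ → Ω → PMF Ω) (j : ℕ) : ℕ → Ω → PMF Ω
  | 0, ω => PMF.pure ω
  | l + 1, ω => (κ j ω).bind (chain κ (j + 1) l)

theorem chain_succ (κ : ℕ → Ω → PMF Ω) (j l : ℕ) (ω : Ω) :
    chain κ j (l + 1) ω = (chain κ j l ω).bind (κ (j + l)) := by
  induction l generalizing j ω with
  | zero =>
    simp only [chain, PMF.pure_bind, add_zero]
    exact PMF.bind_pure _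
  | succ l ih =>
    rw [chain, chain, PMF.bind_bind]
    congr 1
    funext ω'
    rw [ih, show j + 1 + l = j + (l + 1) by omega]

theorem chain_pure (f : ℕ → Ω → Ω) (ω : Ω) (hf : ∀ j, f j ω = ω) (j l : ℕ) :
    chain (fun j ω => PMF.pure (f j ω)) j l ω = PMF.pure ω := by
  induction l generalizing j with
  | zero => rfl
  | succ l ih => rw [chain, PMF.pure_bind, hf, ih]

theorem Triple.while_false {b : Test} (ω : Ω) (hb : ¬ b.holds s) (hQ : Q ω s) :
    Triple (.while b p) s 1 (PMF.pure ω) Q :=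
  .of_step s (fun r => by rw [step, if_neg hb]) ω hQ

/-- Each pass costs `c` steps and one for the test; the last `+ 1` is the failing test. The
induction runs over the remaining passes because `chain` unfolds at its first step. -/
theorem Triple.while_loop {b : Test} (I : ℕ → Ω → State → Prop) (κ : ℕ → Ω → PMF Ω) {c m : ℕ}
    (hstep : ∀ j < m, ∀ ω s, I j ω s → b.holds s ∧ Triple p s c (κ j ω) (I (j + 1)))
    (hend : ∀ ω s, I m ω s → ¬ b.holds s) {ω : Ω} (h0 : I 0 ω s) :
    Triple (.while b p) s (m * (c + 1) + 1) (chain κ 0 m ω) (I m) := by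
  suffices H : ∀ l j, j + l = m → ∀ ω s, I j ω s →
      Triple (.while b p) s (l * (c + 1) + 1) (chain κ j l ω) (I m) from
    H m 0 (zero_add m) ω s h0
  intro l
  induction l with
  | zero =>
    intro j hj ω s h
    obtain rfl : j = m := by omega
    exact (Triple.while_false ω (hend ω s h) h).mono (by omega) fun _ _ h => h
  | succ l ih =>
    intro j hj ω s h
    obtain ⟨hb, hp⟩ := hstep j (by omega) ω s h
    obtain ⟨ξ, h1, h2, h3⟩ := bind_run hp (ih (j + 1) (by omega))
    refine ⟨ξ, h1, h2, fun r N => ?_⟩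
    rw [show (l + 1) * (c + 1) + 1 + N = c + (l * (c + 1) + 1) + N + 1 by ring, run, step,
      if_pos hb, PMF.pure_bind, h3]

/-- A terminating loop without coins. -/
theorem Triple.while_det {b : Test} (I : ℕ → State → Prop) {c m : ℕ}
    (hstep : ∀ j < m, ∀ s, I j s →
      b.holds s ∧ Triple p s c (PMF.pure ()) (fun _ => I (j + 1)))
    (hend : ∀ s, I m s → ¬ b.holds s) (h0 : I 0 s) :
    Triple (.while b p) s (m * (c + 1) + 1) (PMF.pure ()) (fun _ => I m) := by
  have := Triple.while_loop (p := p) (fun j (_ : Unit) => I j) (fun _ _ => PMF.pure ())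
    (fun j hj _ s h => hstep j hj s h) (fun _ s h => hend s h) (ω := ()) h0
  rwa [chain_pure (fun _ _ => ()) () (fun _ => rfl)] at this

theorem State.setNat_nat (s : State) (a i v a' i' : ℕ) :
    (s.setNat a i v).nat a' i' = if a' = a ∧ i' = i then v else s.nat a' i' := by
  simp only [State.setNat, Function.update_apply]
  split_ifs with h1 h2 h2 <;> simp_all

theorem State.setNat_real (s : State) (a i v : ℕ) : (s.setNat a i v).real = s.real := rfl

theorem State.setReal_real (s : State) (a i : ℕ) (v : ℝ) (a' i' : ℕ) :
    (s.setReal a i v).real a' i' = if a' = a ∧ i' = i then v else s.real a' i' := by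
  simp only [State.setReal, Function.update_apply]
  split_ifs with h1 h2 h2 <;> simp_all

theorem State.setReal_nat (s : State) (a i : ℕ) (v : ℝ) : (s.setReal a i v).nat = s.nat := rfl

end RealRAM

/-! ### The permanent of a band matrix by recursion over column masks -/

namespace Mallows

open Equiv Finset

/-- In row `r` of a band matrix of half-width `k`, the entry with offset `d` lies in one of the
columns `0, …, n - 1` and its column is free according to `mask`. -/
def Free (n k r mask d : ℕ) : Prop := k ≤ r + d ∧ r + d + 1 ≤ n + k ∧ mask / 2 ^ d % 2 = 0

instance (n k r mask d : ℕ) : Decidable (Free n k r mask d) := by unfold Free; infer_instance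

/-- The permanent of the last `e` rows of a band matrix with entries `wt d` at offset `d`, without
the columns that are used according to `mask`. Bit `d` of `mask` stands for the column with
offset `d` in the first of these rows. -/
noncomputable def bandPermanent (n k : ℕ) (wt : ℕ → ℝ) : ℕ → ℕ → ℝ
  | 0, _ => 1
  | e + 1, mask => ∑ d ∈ range (2 * k + 1),
      if Free n k (n - (e + 1)) mask d then wt d * bandPermanent n k wt e ((mask + 2 ^ d) / 2) else 0

/-- The contribution of the entry with offset `d` to the expansion along the first row. -/
noncomputable def rowTerm (n k : ℕ) (wt : ℕ → ℝ) (e mask d : ℕ) : ℝ :=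
  if Free n k (n - (e + 1)) mask d then wt d * bandPermanent n k wt e ((mask + 2 ^ d) / 2) else 0

theorem bandPermanent_succ (n k : ℕ) (wt : ℕ → ℝ) (e mask : ℕ) :
    bandPermanent n k wt (e + 1) mask = ∑ d ∈ range (2 * k + 1), rowTerm n k wt e mask d := rfl

theorem bandPermanent_nonneg (n k : ℕ) {wt : ℕ → ℝ} (hwt : ∀ d, 0 ≤ wt d) (e mask : ℕ) :
    0 ≤ bandPermanent n k wt e mask := by
  induction e generalizing mask with
  | zero => exact zero_le_one
  | succ e ih =>
    refine sum_nonneg fun d _ => ?_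
    have := mul_nonneg (hwt d) (ih ((mask + 2 ^ d) / 2))
    split_ifs <;> linarith

theorem rowTerm_nonneg (n k : ℕ) {wt : ℕ → ℝ} (hwt : ∀ d, 0 ≤ wt d) (e mask d : ℕ) :
    0 ≤ rowTerm n k wt e mask d := by
  have := mul_nonneg (hwt d) (bandPermanent_nonneg n k hwt e ((mask + 2 ^ d) / 2))
  unfold rowTerm
  split_ifs <;> linarith

variable {n : ℕ}

/-- The positions before `j`. -/
def rowsBelow (n j : ℕ) : Finset (Fin n) := {i : Fin n | (i : ℕ) < j}

/-- The positions from `j` on. -/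
def rowsFrom (n j : ℕ) : Finset (Fin n) := {i : Fin n | j ≤ (i : ℕ)}

theorem mem_rowsBelow {j : ℕ} {i : Fin n} : i ∈ rowsBelow n j ↔ (i : ℕ) < j := by
  simp [rowsBelow]

theorem mem_rowsFrom {j : ℕ} {i : Fin n} : i ∈ rowsFrom n j ↔ j ≤ (i : ℕ) := by
  simp [rowsFrom]

/-- The set of the values of the first `j` positions, as a number: bit `c + k` stands for `c`. -/
def usedMask (k j : ℕ) (τ : Perm (Fin n)) : ℕ :=
  ∑ i ∈ rowsBelow n j, 2 ^ ((τ i : ℕ) + k)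

theorem testBit_usedMask (k j : ℕ) (τ : Perm (Fin n)) (b : ℕ) :
    (usedMask k j τ).testBit b ↔ ∃ i : Fin n, (i : ℕ) < j ∧ (τ i : ℕ) + k = b := by
  have h : usedMask k j τ =
      ∑ b ∈ (rowsBelow n j).image (fun i => (τ i : ℕ) + k), 2 ^ b := by
    rw [sum_image]
    · rfl
    · intro a _ b _ hab
      exact τ.injective (Fin.ext (by simpa using hab))
  rw [← Nat.mem_bitIndices, ← List.mem_toFinset, h, toFinset_bitIndices_sum_two_pow]
  simp [mem_rowsBelow]

theorem usedMask_succ (k : ℕ) (τ : Perm (Fin n)) (j : Fin n) :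
    usedMask k (j + 1) τ = usedMask k j τ + 2 ^ ((τ j : ℕ) + k) := by
  unfold usedMask
  have : rowsBelow n (j + 1) = insert j (rowsBelow n j) := by
    ext i
    simp only [mem_rowsBelow, mem_insert, Fin.ext_iff]
    omega
  rw [this, sum_insert (by simp [mem_rowsBelow]), add_comm]

theorem usedMask_zero (k : ℕ) (τ : Perm (Fin n)) : usedMask k 0 τ = 0 := by
  simp [usedMask, rowsBelow]

/-- Advancing one row shifts the window of columns by one: marking offset `d` and dropping bit `0`
amounts to marking bit `j + d` before a longer shift. The dropped column is out of reach of all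
later rows. -/
theorem mask_step (X j d : ℕ) : (X / 2 ^ j + 2 ^ d) / 2 = (X + 2 ^ (j + d)) / 2 ^ (j + 1) := by
  rw [pow_add, mul_comm (2 ^ j), ← Nat.add_mul_div_right _ _ (by positivity), Nat.div_div_eq_div_mul,
    pow_succ]

theorem usedMask_step {k : ℕ} (τ : Perm (Fin n)) (j : Fin n) {d : ℕ} (hd : (j : ℕ) + d = τ j + k) :
    (usedMask k j τ / 2 ^ (j : ℕ) + 2 ^ d) / 2 = usedMask k (j + 1) τ / 2 ^ ((j : ℕ) + 1) := by
  rw [mask_step, usedMask_succ, hd]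

theorem free_iff {k j d : ℕ} (τ : Perm (Fin n)) :
    Free n k j (usedMask k j τ / 2 ^ j) d ↔
      k ≤ j + d ∧ j + d + 1 ≤ n + k ∧ ∀ i : Fin n, (i : ℕ) < j → (τ i : ℕ) + k ≠ j + d := by
  have h := testBit_usedMask k j τ (j + d)
  rw [Nat.testBit_eq_decide_div_mod_eq, decide_eq_true_eq] at h
  unfold Free
  rw [Nat.div_div_eq_div_mul, ← pow_add]
  refine and_congr_right fun _ => and_congr_right fun _ => ?_
  rw [show ∀ x : ℕ, (x % 2 = 0 ↔ ¬ x % 2 = 1) by omega, h]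
  push Not
  rfl

/-- The weight at offset `d` of the band matrix of half-width `k`. -/
noncomputable def offsetWeight (α β : ℝ) (k d : ℕ) : ℝ := Real.exp (-β * cost α d k)

theorem offsetWeight_pos (α β : ℝ) (k d : ℕ) : 0 < offsetWeight α β k d := Real.exp_pos _

theorem offsetWeight_eq {α β : ℝ} {k d : ℕ} {i j : Fin n} (hd : (i : ℕ) + d = j + k)
    (hdk : d < 2 * k + 1) : offsetWeight α β k d = bandMatrix n α β k i j := by
  rw [bandMatrix_apply, if_pos (by omega), offsetWeight, cost_comm α i, cost, cost]
  have : (i : ℝ) + d = j + k := by exact_mod_cast hd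
  rw [show (d : ℝ) - k = j - i by linarith]

/-- The permutations that agree with `ρ` before `j`. -/
def agreeing (j : ℕ) (ρ : Perm (Fin n)) : Finset (Perm (Fin n)) :=
  {τ | ∀ i : Fin n, (i : ℕ) < j → τ i = ρ i}

theorem mem_agreeing {j : ℕ} {ρ τ : Perm (Fin n)} :
    τ ∈ agreeing j ρ ↔ ∀ i : Fin n, (i : ℕ) < j → τ i = ρ i := by simp [agreeing]

/-- A choice of the first values is encoded by any permutation extending it. The transposition
prescribes the value at `j` and leaves the earlier values alone, since `c` is not among them. -/
theorem agreeing_filter {ρ : Perm (Fin n)} {j c : Fin n} (hc : ∀ i < j, ρ i ≠ c) :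
    {τ ∈ agreeing j ρ | τ j = c} = agreeing (j + 1) (swap (ρ j) c * ρ) := by
  ext τ
  rw [mem_filter, mem_agreeing, mem_agreeing]
  have h1 : ∀ i : Fin n, (i : ℕ) < j → (swap (ρ j) c * ρ) i = ρ i := fun i hi => by
    rw [Perm.mul_apply, swap_apply_of_ne_of_ne _ (hc i hi)]
    intro h
    rw [ρ.injective h] at hi
    omega
  have h2 : (swap (ρ j) c * ρ) j = c := by rw [Perm.mul_apply, swap_apply_left]
  constructor
  · rintro ⟨h, h'⟩ i hi
    rcases Nat.lt_succ_iff_lt_or_eq.1 hi with hi | hi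
    · rw [h1 i hi, h i hi]
    · rw [Fin.ext hi, h2, h']
  · intro h
    refine ⟨fun i hi => ?_, ?_⟩
    · rw [h i (by omega), h1 i hi]
    · rw [h j (by omega), h2]

/-- Expansion along row `j` of the permanent with prescribed values before `j`. -/
theorem sum_agreeing_expand (A : Matrix (Fin n) (Fin n) ℝ) (ρ : Perm (Fin n)) (j : Fin n) :
    ∑ τ ∈ agreeing j ρ, ∏ i ∈ rowsFrom n j, A i (τ i) =
      ∑ c : Fin n with ∀ i < j, ρ i ≠ c, A j c *
        ∑ τ ∈ agreeing (j + 1) (swap (ρ j) c * ρ), ∏ i ∈ rowsFrom n (j + 1), A i (τ i) := by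
  rw [← sum_fiberwise (agreeing j ρ) (fun τ => τ j)]
  rw [sum_filter]
  refine sum_congr rfl fun c _ => ?_
  split_ifs with hc
  · rw [agreeing_filter hc, mul_sum]
    refine sum_congr rfl fun τ hτ => ?_
    have e : rowsFrom n j = insert j (rowsFrom n (j + 1)) := by
      ext i
      simp only [mem_rowsFrom, mem_insert, Fin.ext_iff]
      omega
    have hj := mem_agreeing.1 hτ j (by omega)
    rw [Perm.mul_apply, swap_apply_left] at hj
    rw [e, prod_insert (by simp [mem_rowsFrom]), hj]
  · push Not at hc
    obtain ⟨i, hi, hic⟩ := hc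
    refine sum_eq_zero fun τ hτ => ?_
    rw [mem_filter, mem_agreeing] at hτ
    have := hτ.1 i hi
    rw [hic, ← hτ.2] at this
    exact absurd (τ.injective this) hi.ne

/-- Expansion along the first remaining row matches the recursion under `d = c + k - j`; columns
outside the band contribute zero. The statement is for all `ρ` because each branch of the expansion
changes the prefix. -/
theorem bandPermanent_eq_sum (α β : ℝ) (k : ℕ) (e : ℕ) (he : e ≤ n) (ρ : Perm (Fin n)) :
    bandPermanent n k (offsetWeight α β k) e (usedMask k (n - e) ρ / 2 ^ (n - e)) =
      ∑ τ ∈ agreeing (n - e) ρ, ∏ i ∈ rowsFrom n (n - e), bandMatrix n α β k i (τ i) := by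
  induction e generalizing ρ with
  | zero =>
    have h1 : agreeing (n - 0) ρ = {ρ} := by
      ext τ
      rw [mem_agreeing, mem_singleton]
      exact ⟨fun h => Equiv.ext fun i => h i (by omega), fun h i _ => by rw [h]⟩
    have h2 : rowsFrom n (n - 0) = ∅ := by
      ext i; simp [mem_rowsFrom]
    rw [h1, h2, sum_singleton, prod_empty, bandPermanent]
  | succ e ih =>
    obtain ⟨j, hj⟩ : ∃ j : Fin n, (j : ℕ) = n - (e + 1) := ⟨⟨n - (e + 1), by omega⟩, rfl⟩
    have hj1 : n - e = j + 1 := by omega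
    rw [bandPermanent, ← hj, sum_agreeing_expand]
    rw [hj1] at ih
    rw [← sum_filter]
    have hz : ∑ c : Fin n with ∀ i < j, ρ i ≠ c, bandMatrix n α β k j c *
        ∑ τ ∈ agreeing (j + 1) (swap (ρ j) c * ρ),
          ∏ i ∈ rowsFrom n (j + 1), bandMatrix n α β k i (τ i) =
      ∑ c : Fin n with (∀ i < j, ρ i ≠ c) ∧ ((j : ℕ) ≤ c + k ∧ (c : ℕ) ≤ j + k),
        bandMatrix n α β k j c * ∑ τ ∈ agreeing (j + 1) (swap (ρ j) c * ρ),
          ∏ i ∈ rowsFrom n (j + 1), bandMatrix n α β k i (τ i) := by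
      rw [← filter_filter, eq_comm]
      refine sum_subset (filter_subset _ _) fun c hc hc' => ?_
      rw [bandMatrix_apply, if_neg, zero_mul]
      intro h
      exact hc' (mem_filter.2 ⟨hc, h⟩)
    rw [hz]
    symm
    refine sum_bij (fun c _ => (c : ℕ) + k - j) ?_ ?_ ?_ ?_
    · intro c hc
      simp only [mem_filter, mem_univ, true_and, mem_range] at hc ⊢
      refine ⟨by omega, (free_iff ρ).2 ⟨by omega, by omega, fun i hi h => ?_⟩⟩
      exact hc.1 i hi (Fin.ext (by omega))
    · intro c hc c' hc' h
      simp only [mem_filter, mem_univ, true_and] at hc hc'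
      exact Fin.ext (by omega)
    · intro d hd
      simp only [mem_filter, mem_range] at hd
      obtain ⟨hd1, hd2⟩ := hd
      obtain ⟨h1, h2, h3⟩ := (free_iff ρ).1 hd2
      refine ⟨⟨j + d - k, by omega⟩, ?_, by simp only; omega⟩
      simp only [mem_filter, mem_univ, true_and]
      refine ⟨fun i hi h => h3 i hi ?_, by omega, by omega⟩
      rw [h]
      simp only
      omega
    · intro c hc
      simp only [mem_filter, mem_univ, true_and] at hc
      have hd : (j : ℕ) + (c + k - j) = (swap (ρ j) c * ρ) j + k := by
        rw [Perm.mul_apply, swap_apply_left]; omega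
      have hu : usedMask k j ρ = usedMask k j (swap (ρ j) c * ρ) := by
        unfold usedMask
        refine sum_congr rfl fun i hi => ?_
        rw [mem_rowsBelow] at hi
        rw [Perm.mul_apply, swap_apply_of_ne_of_ne _ (hc.1 i hi)]
        intro h
        rw [ρ.injective h] at hi
        omega
      rw [hu, usedMask_step _ j hd, ih (by omega), offsetWeight_eq (i := j) (j := c) (by omega)
        (by omega)]

theorem bandPermanent_eq_permanent (n : ℕ) (α β : ℝ) (k : ℕ) :
    bandPermanent n k (offsetWeight α β k) n 0 = (bandMatrix n α β k).permanent := by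
  have h := bandPermanent_eq_sum α β k n le_rfl 1
  rw [Nat.sub_self, usedMask_zero, Nat.zero_div] at h
  rw [h, permanent_bandMatrix, sum_filter]
  refine sum_congr ?_ fun τ _ => ?_
  · ext τ; simp [mem_agreeing]
  · rw [← prod_bandMatrix]
    exact prod_congr (by ext i; simp [mem_rowsFrom]) fun _ _ => rfl

end Mallows

/-! ### Reservoir sampling -/

namespace RealRAM

open Finset

/-- Both total masses are `1`, so no inequality can be strict. Correctness of the sampler thus needs
only lower bounds, that is, one favourable course of the coins for each outcome. -/
theorem eq_of_forall_le {A : Type*} {p q : PMF A} (h : ∀ a, q a ≤ p a) : q = p := by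
  ext a
  refine le_antisymm (h a) (not_lt.1 fun hlt => ?_)
  have := ENNReal.tsum_lt_tsum (by rw [q.tsum_coe]; exact ENNReal.one_ne_top) h hlt
  rw [p.tsum_coe, q.tsum_coe] at this
  exact lt_irrefl _ this

theorem apply_mul_apply_le_bind {A B : Type*} (p : PMF A) (f : A → PMF B) (a : A) (b : B) :
    p a * f a b ≤ p.bind f b := by
  rw [PMF.bind_apply]
  exact ENNReal.le_tsum a

theorem le_bind_apply {A B : Type*} (p : PMF A) (f : A → PMF B) (b : B) (x : ENNReal)
    (h : ∀ a, x ≤ f a b) : x ≤ p.bind f b := by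
  rw [PMF.bind_apply]
  calc x = ∑' a, p a * x := by rw [ENNReal.tsum_mul_right, p.tsum_coe, one_mul]
    _ ≤ ∑' a, p a * f a b := ENNReal.tsum_le_tsum fun a => mul_le_mul_right (h a) _

theorem apply_le_map_apply {A B : Type*} (p : PMF A) (f : A → B) (a : A) :
    p a ≤ p.map f (f a) := by
  rw [PMF.map_apply]
  refine le_trans ?_ (ENNReal.le_tsum a)
  simp

theorem coin_true {x : ℝ} (h0 : 0 ≤ x) (h1 : x ≤ 1) : coin x true = ENNReal.ofReal x := by
  simp [coin, h0, h1]

theorem coin_false {x : ℝ} (h0 : 0 ≤ x) (h1 : x ≤ 1) : coin x false = ENNReal.ofReal (1 - x) := by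
  simp [coin, h0, h1]

/-- One step of reservoir sampling: with probability `f d / ∑ d' ≤ d, f d'`, the current choice is
replaced by `out d`. -/
noncomputable def reservoirStep {A : Type} (V : ℕ → Prop) [DecidablePred V] (f : ℕ → ℝ)
    (out : ℕ → A) (d : ℕ) (a : A) : PMF A :=
  if V d then (coin (f d / ∑ d' ∈ range (d + 1), f d')).bind
    fun b => PMF.pure (if b then out d else a)
  else PMF.pure a

/-- Reservoir sampling selects `out c` with probability at least proportional to `f c`. -/
theorem le_chain_reservoirStep {A : Type} (V : ℕ → Prop) [DecidablePred V] (f : ℕ → ℝ)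
    (hf : ∀ d, 0 ≤ f d) (hV : ∀ d, ¬ V d → f d = 0) (out : ℕ → A) (a : A) (m c : ℕ) (hc : c < m) :
    ENNReal.ofReal (f c / ∑ d ∈ range m, f d) ≤ chain (reservoirStep V f out) 0 m a (out c) := by
  induction m with
  | zero => omega
  | succ m ih =>
    rw [chain_succ, zero_add]
    have hT : ∀ l, 0 ≤ ∑ d ∈ range l, f d := fun l => sum_nonneg fun d _ => hf d
    have hsum : ∑ d ∈ range (m + 1), f d = ∑ d ∈ range m, f d + f m := sum_range_succ _ _
    have hx0 : 0 ≤ f m / ∑ d ∈ range (m + 1), f d := div_nonneg (hf m) (hT _)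
    have hx1 : f m / ∑ d ∈ range (m + 1), f d ≤ 1 :=
      div_le_one_of_le₀ (by rw [hsum]; linarith [hT m]) (hT _)
    rcases Nat.lt_succ_iff_lt_or_eq.1 hc with hc | rfl
    -- An earlier choice `c` survives step `m` with probability `S m / S (m + 1)`, where `S` denotes
    -- the partial sums; this replaces the denominator `S m` by `S (m + 1)`.
    · refine le_trans ?_ (apply_mul_apply_le_bind _ _ (out c) _)
      refine le_trans ?_ (mul_le_mul_left (ih hc) _)
      by_cases hm : V m
      · have h1 : ENNReal.ofReal (1 - f m / ∑ d ∈ range (m + 1), f d) ≤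
            reservoirStep V f out m (out c) (out c) := by
          rw [reservoirStep, if_pos hm, ← coin_false hx0 hx1]
          refine le_trans ?_ (apply_mul_apply_le_bind _ _ false _)
          simp
        refine le_trans ?_ (mul_le_mul_right h1 _)
        rw [← ENNReal.ofReal_mul (div_nonneg (hf c) (hT m))]
        refine ENNReal.ofReal_le_ofReal (le_of_eq ?_)
        -- If the partial sum is zero, so is `f c`, and the bound is trivial.
        rcases (hT m).eq_or_lt with h0 | h0
        · have : f c = 0 := le_antisymm
            (h0 ▸ single_le_sum (fun d _ => hf d) (mem_range.2 hc)) (hf c)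
          rw [this]; simp
        · have : 0 < ∑ d ∈ range m, f d + f m := by linarith [hf m]
          rw [hsum]
          field_simp
          ring
      · rw [reservoirStep, if_neg hm, hsum, hV m hm, add_zero]
        simp
    · by_cases hm : V c
      · refine le_bind_apply _ _ _ _ fun b => ?_
        rw [reservoirStep, if_pos hm, ← coin_true hx0 hx1]
        refine le_trans ?_ (apply_mul_apply_le_bind _ _ true _)
        simp
      · rw [hV c hm]
        simp

end RealRAM

/-! ### Exact sampling row by row -/

namespace Mallows

open Equiv Finset RealRAM

/-- The random choice of the column in the first of the last `e + 1` rows. The result consists of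
the new mask and of the column. -/
noncomputable def rowStep (n k : ℕ) (wt : ℕ → ℝ) (e mask : ℕ) : ℕ → ℕ × ℕ → PMF (ℕ × ℕ) :=
  reservoirStep (Free n k (n - (e + 1)) mask) (rowTerm n k wt e mask)
    fun d => ((mask + 2 ^ d) / 2, n - (e + 1) + d - k)

/-- The random choice of the column of row `j`, given the mask and the previous columns. -/
noncomputable def sampleStep (n k : ℕ) (wt : ℕ → ℝ) (j : ℕ) (ω : ℕ × (ℕ → ℕ)) :
    PMF (ℕ × (ℕ → ℕ)) :=
  (chain (rowStep n k wt (n - (j + 1)) ω.1) 0 (2 * k + 1) (0, 0)).map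
    fun x => (x.1, Function.update ω.2 j x.2)

variable {n : ℕ}

/-- The values of the first `j` positions, and those of `g` for the others. -/
def firstValues (τ : Perm (Fin n)) (g : ℕ → ℕ) (j i : ℕ) : ℕ :=
  if h : i < n ∧ i < j then (τ ⟨i, h.1⟩ : ℕ) else g i

theorem firstValues_succ (τ : Perm (Fin n)) (g : ℕ → ℕ) (j : Fin n) :
    firstValues τ g (j + 1) = Function.update (firstValues τ g j) j (τ j) := by
  funext i
  by_cases hi : i = j
  · subst hi
    rw [Function.update_self]
    simp [firstValues]
  · rw [Function.update_of_ne hi]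
    unfold firstValues
    have : (i < n ∧ i < (j : ℕ) + 1) ↔ (i < n ∧ i < j) := by omega
    simp only [this]

/-- Row `j` picks the column of `τ` with probability at least its term divided by the current
partial permanent. That term is the entry times the next partial permanent, so the product
telescopes. -/
theorem le_chain_sampleStep (α β : ℝ) {k : ℕ} {τ : Perm (Fin n)} (hτ : InBand k τ) (g : ℕ → ℕ)
    (j : ℕ) (hj : j ≤ n) :
    ENNReal.ofReal ((∏ i ∈ rowsBelow n j, bandMatrix n α β k i (τ i)) *
      bandPermanent n k (offsetWeight α β k) (n - j) (usedMask k j τ / 2 ^ j) /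
        (bandMatrix n α β k).permanent) ≤
      chain (sampleStep n k (offsetWeight α β k)) 0 j (0, g)
        (usedMask k j τ / 2 ^ j, firstValues τ g j) := by
  have hwt : ∀ d, 0 ≤ offsetWeight α β k d := fun d => (offsetWeight_pos α β k d).le
  induction j with
  | zero =>
    have h1 : rowsBelow n 0 = ∅ := by ext i; simp [mem_rowsBelow]
    have h2 : firstValues τ g 0 = g := by funext i; simp [firstValues]
    rw [h1, prod_empty, one_mul, usedMask_zero, Nat.zero_div, Nat.sub_zero,
      bandPermanent_eq_permanent, div_self (permanent_bandMatrix_pos n α β k).ne', h2, chain]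
    simp
  | succ j ih =>
    obtain ⟨i, hi⟩ : ∃ i : Fin n, (i : ℕ) = j := ⟨⟨j, by omega⟩, rfl⟩
    subst hi
    rw [chain_succ, zero_add]
    refine le_trans ?_ (apply_mul_apply_le_bind _ _ (usedMask k i τ / 2 ^ (i : ℕ),
      firstValues τ g i) _)
    refine le_trans ?_ (mul_le_mul_left (ih (by omega)) _)
    obtain ⟨d, hd⟩ : ∃ d, (i : ℕ) + d = τ i + k := ⟨τ i + k - i, by have := hτ i; omega⟩
    have hdk : d < 2 * k + 1 := by have := hτ i; omega
    set e := n - ((i : ℕ) + 1) with he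
    have hei : n - (e + 1) = i := by omega
    set mask := usedMask k i τ / 2 ^ (i : ℕ) with hmask
    have hterm : rowTerm n k (offsetWeight α β k) e mask d = bandMatrix n α β k i (τ i) *
        bandPermanent n k (offsetWeight α β k) e (usedMask k (i + 1) τ / 2 ^ ((i : ℕ) + 1)) := by
      rw [rowTerm, if_pos, hmask, usedMask_step τ i hd, offsetWeight_eq hd hdk]
      rw [hei, hmask]
      refine (free_iff τ).2 ⟨by omega, by omega, fun i' hi' h => ?_⟩
      have : τ i' = τ i := Fin.ext (by omega)
      rw [τ.injective this] at hi'
      omega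
    have hstep : ENNReal.ofReal (rowTerm n k (offsetWeight α β k) e mask d /
        bandPermanent n k (offsetWeight α β k) (e + 1) mask) ≤
        sampleStep n k (offsetWeight α β k) i (mask, firstValues τ g i)
          (usedMask k (i + 1) τ / 2 ^ ((i : ℕ) + 1), firstValues τ g (i + 1)) := by
      have h1 := le_chain_reservoirStep (Free n k (n - (e + 1)) mask)
        (rowTerm n k (offsetWeight α β k) e mask) (rowTerm_nonneg n k hwt e mask)
        (fun d hd => by rw [rowTerm, if_neg hd])
        (fun d => ((mask + 2 ^ d) / 2, n - (e + 1) + d - k)) (0, 0) (2 * k + 1) d hdk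
      rw [← bandPermanent_succ] at h1
      refine h1.trans ?_
      refine (apply_le_map_apply _ (fun x : ℕ × ℕ =>
        (x.1, Function.update (firstValues τ g i) i x.2)) _).trans (le_of_eq ?_)
      have h2 : (mask + 2 ^ d) / 2 = usedMask k (i + 1) τ / 2 ^ ((i : ℕ) + 1) := by
        rw [hmask, usedMask_step τ i hd]
      have h3 : n - (e + 1) + d - k = τ i := by omega
      rw [sampleStep, firstValues_succ, ← h2, ← h3]
      rfl
    refine le_trans ?_ (mul_le_mul_right hstep _)
    have hA : ∀ i j, 0 ≤ bandMatrix n α β k i j := fun i j => by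
      unfold bandMatrix; split_ifs <;> positivity
    have hP : 0 ≤ ∏ x ∈ rowsBelow n i, bandMatrix n α β k x (τ x) :=
      prod_nonneg fun x _ => hA _ _
    have hZ := permanent_bandMatrix_pos n α β k
    rw [show n - (i : ℕ) = e + 1 by omega]
    have hB := bandPermanent_nonneg n k hwt (e + 1) mask
    rw [← ENNReal.ofReal_mul (div_nonneg (mul_nonneg hP hB) hZ.le), hterm]
    refine ENNReal.ofReal_le_ofReal (le_of_eq ?_)
    have hins : rowsBelow n (i + 1) = insert i (rowsBelow n i) := by
      ext x
      simp only [mem_rowsBelow, mem_insert, Fin.ext_iff]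
      omega
    rw [hins, prod_insert (by simp [mem_rowsBelow])]
    -- A vanishing partial permanent makes the chosen term vanish, so nothing is claimed where the
    -- quotient degenerates.
    rcases hB.eq_or_lt with h0 | h0
    · have h1 : rowTerm n k (offsetWeight α β k) e mask d = 0 := by
        refine le_antisymm ?_ (rowTerm_nonneg n k hwt e mask d)
        rw [h0, bandPermanent_succ]
        exact single_le_sum (fun d _ => rowTerm_nonneg n k hwt e mask d) (mem_range.2 hdk)
      rw [hterm] at h1
      rw [mul_right_comm, h1, ← h0]
      simp
    · field_simp

/-- Sampling row by row, and then composing with the central ranking, produces the truncated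
Mallows distribution. -/
theorem chain_sampleStep_map (α β : ℝ) (k : ℕ) (σ : Perm (Fin n)) (g : ℕ → ℕ) :
    (chain (sampleStep n k (offsetWeight α β k)) 0 n (0, g)).map
      (fun ω (i : Fin n) => ω.2 (σ i)) = (truncatedMallows α β k σ).map values := by
  symm
  refine eq_of_forall_le fun f => ?_
  by_cases hf : ∃ π : Perm (Fin n), values π = f
  · obtain ⟨π, rfl⟩ := hf
    have hinj : Function.Injective (values (n := n)) := fun π ρ h =>
      Equiv.ext fun i => Fin.ext (congrFun h i)
    have h1 : (truncatedMallows α β k σ).map values (values π) = truncatedMallows α β k σ π := by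
      rw [PMF.map_apply, tsum_eq_single π]
      · simp
      · intro ρ hρ
        rw [if_neg fun h => hρ (hinj h).symm]
    rw [h1, truncatedMallows_apply]
    by_cases hb : InBand k (π * σ⁻¹)
    -- The sampled columns are to be those of `τ = π * σ⁻¹`; reading them at `σ i` returns `π i`.
    · have h2 := le_chain_sampleStep α β hb g n le_rfl
      have h3 : rowsBelow n n = univ := by ext i; simp [mem_rowsBelow]
      rw [h3, Nat.sub_self, bandPermanent, mul_one] at h2
      refine h2.trans ((apply_le_map_apply _ (fun ω (i : Fin n) => ω.2 (σ i)) _).trans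
        (le_of_eq ?_))
      congr 1
      funext i
      simp [firstValues, values]
    · rw [prod_bandMatrix, if_neg hb]
      simp
  · have : (truncatedMallows α β k σ).map values f = 0 := by
      rw [PMF.apply_eq_zero_iff, PMF.mem_support_map_iff]
      rintro ⟨π, _, h⟩
      exact hf ⟨π, h⟩
    rw [this]
    exact zero_le

end Mallows

/-! ### The program that tabulates the partial permanents -/

namespace RealRAM

open Mallows Finset

/-! The programs use the following memory layout. Integer arrays: `0` holds `n`, `1` the central
ranking, `2` the output, `3` the half-width `k`, `4` the number `2 ^ (2 * k + 1)` of masks, `5` a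
pointer into the table, `6` an offset `d`, `7` the power `2 ^ d`, `8` the next pointer, `9` the
selected column, `10` the selected columns of all rows, `11` a counter. Real arrays: `0` holds
`α, β, ε`, `1` the output, `2` a power of two, `3` the table of the partial permanents, `4` a sum
and `5` a summand. -/

/-- The integer variable in cell `0` of array `a`. -/
def nvar (a : ℕ) : NExpr := .load a (.const 0)

/-- The real variable in cell `0` of array `a`. -/
def rvar (a : ℕ) : RExpr := .load a (.const 0)

/-- Table cell `e * 2 ^ (2 * k + 1) + mask` holds the partial permanent of the last `e` rows.
Quotient and remainder of the pointer recover `e` and `mask`, and no integer product is ever needed.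
-/
def rowExpr : NExpr := .sub (nvar 0) (.div (nvar 5) (nvar 4))

def maskExpr : NExpr := .mod (nvar 5) (nvar 4)

def nextBase : NExpr := .sub (.sub (nvar 5) maskExpr) (nvar 4)

def nextExpr : NExpr := .add nextBase (.div (.add maskExpr (nvar 7)) (.const 2))

def freeTest : Test :=
  .and (.natLe (nvar 3) (.add rowExpr (nvar 6)))
    (.and (.natLe (.add (.add rowExpr (nvar 6)) (.const 1)) (.add (nvar 0) (nvar 3)))
      (.natLe (.mod (.div maskExpr (nvar 7)) (.const 2)) (.const 0)))

/-- The distance of the offset to the diagonal. -/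
def gapExpr : RExpr := .ofNat (.add (.sub (nvar 6) (nvar 3)) (.sub (nvar 3) (nvar 6)))

def weightExpr : RExpr :=
  .exp (.sub (.ofNat (.const 0)) (.mul (.load 0 (.const 1)) (.mul gapExpr
    (.exp (.mul (.sub (rvar 0) (.ofNat (.const 1))) (.log gapExpr))))))

def termExpr : RExpr := .mul weightExpr (.load 3 nextExpr)

def offsetsLeft : Test :=
  .natLe (.add (nvar 6) (.const 1)) (.add (.add (nvar 3) (nvar 3)) (.const 1))

def nextOffset : Prog :=
  .seq (.setNat 6 (.const 0) (.add (nvar 6) (.const 1)))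
    (.setNat 7 (.const 0) (.add (nvar 7) (nvar 7)))

def addTerm : Prog :=
  .seq (.ite freeTest (.setReal 4 (.const 0) (.add (rvar 4) termExpr)) .skip) nextOffset

/-- Expansion of a partial permanent along its first row. -/
def expandRow : Prog :=
  .seq (.setReal 4 (.const 0) (.ofNat (.const 0)))
    (.seq (.setNat 6 (.const 0) (.const 0))
      (.seq (.setNat 7 (.const 0) (.const 1)) (.while offsetsLeft addTerm)))

def fillCell : Prog :=
  .seq (.ite (.natLe (nvar 4) (nvar 5)) expandRow (.setReal 4 (.const 0) (.ofNat (.const 1))))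
    (.seq (.setReal 3 (nvar 5) (rvar 4)) (.setNat 5 (.const 0) (.add (nvar 5) (.const 1))))

/-- Computation of all partial permanents. -/
def fillTable : Prog :=
  .seq (.setNat 5 (.const 0) (.const 0))
    (.while (.natLe (.div (nvar 5) (nvar 4)) (nvar 0)) fillCell)

/-- The data that the following programs leave unchanged. -/
structure Ready (n k : ℕ) (α β : ℝ) (c : ℕ → ℕ) (s : State) : Prop where
  size : s.nat 0 0 = n
  width : s.nat 3 0 = k
  masks : s.nat 4 0 = 2 ^ (2 * k + 1)
  exponent : s.real 0 0 = α
  dispersion : s.real 0 1 = β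
  center : s.nat 1 = c

variable {n k : ℕ} {α β : ℝ} {c : ℕ → ℕ} {s : State}

theorem Ready.setNat (h : Ready n k α β c s) {a i v : ℕ} (ha : 4 < a) :
    Ready n k α β c (s.setNat a i v) := by
  obtain ⟨h1, h2, h3, h4, h5, h6⟩ := h
  refine ⟨?_, ?_, ?_, h4, h5, ?_⟩ <;>
  · simp only [State.setNat]
    rw [Function.update_of_ne (by omega)]
    assumption

theorem Ready.setReal (h : Ready n k α β c s) {a i : ℕ} {v : ℝ} (ha : 0 < a) :
    Ready n k α β c (s.setReal a i v) := by
  obtain ⟨h1, h2, h3, h4, h5, h6⟩ := h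
  refine ⟨h1, h2, h3, ?_, ?_, h6⟩ <;>
  · simp only [State.setReal]
    rw [Function.update_of_ne (by omega)]
    assumption

/-- The table is correct below `B`. -/
def TableBelow (n k : ℕ) (α β : ℝ) (B : ℕ) (s : State) : Prop :=
  ∀ y < B, s.real 3 y =
    bandPermanent n k (offsetWeight α β k) (y / 2 ^ (2 * k + 1)) (y % 2 ^ (2 * k + 1))

/-- The row with `e` rows after it is being expanded, at offset `d`. -/
structure Scan (n k : ℕ) (α β : ℝ) (c : ℕ → ℕ) (B e mask d : ℕ) (acc : ℝ) (s : State) : Prop where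
  ready : Ready n k α β c s
  pointer : s.nat 5 0 = (e + 1) * 2 ^ (2 * k + 1) + mask
  offset : s.nat 6 0 = d
  power : s.nat 7 0 = 2 ^ d
  sum : s.real 4 0 = acc
  table : TableBelow n k α β B s

variable {B e mask d : ℕ} {acc : ℝ}

/-- The power is computed from `exp` and `log` without a case distinction: at `0` the outer factor
makes the value of the logarithm irrelevant. -/
theorem rpow_eq_mul_exp (hα : α ≠ 0) {x : ℝ} (hx : 0 ≤ x) :
    x * Real.exp ((α - 1) * Real.log x) = x ^ α := by
  rcases hx.eq_or_lt with rfl | h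
  · rw [zero_mul, Real.zero_rpow hα]
  · rw [mul_comm (α - 1), ← Real.rpow_def_of_pos h, Real.rpow_sub_one h.ne']
    field_simp

theorem Scan.eval_mask (h : Scan n k α β c B e mask d acc s) (hm : mask < 2 ^ (2 * k + 1)) :
    maskExpr.eval s = mask := by
  simp only [maskExpr, nvar, NExpr.eval, h.pointer, h.ready.masks]
  rw [Nat.mul_add_mod_of_lt hm]

theorem Scan.eval_row (h : Scan n k α β c B e mask d acc s) (hm : mask < 2 ^ (2 * k + 1)) :
    rowExpr.eval s = n - (e + 1) := by
  simp only [rowExpr, nvar, NExpr.eval, h.pointer, h.ready.masks, h.ready.size]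
  rw [Nat.mul_comm, Nat.mul_add_div (by positivity), Nat.div_eq_of_lt hm, add_zero]

theorem Scan.eval_nextBase (h : Scan n k α β c B e mask d acc s) (hm : mask < 2 ^ (2 * k + 1)) :
    nextBase.eval s = e * 2 ^ (2 * k + 1) := by
  simp only [nextBase, NExpr.eval, h.eval_mask hm]
  simp only [nvar, NExpr.eval, h.pointer, h.ready.masks]
  rw [Nat.add_sub_cancel, Nat.succ_mul, Nat.add_sub_cancel]

theorem Scan.eval_next (h : Scan n k α β c B e mask d acc s) (hm : mask < 2 ^ (2 * k + 1)) :
    nextExpr.eval s = e * 2 ^ (2 * k + 1) + (mask + 2 ^ d) / 2 := by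
  simp only [nextExpr, NExpr.eval, h.eval_nextBase hm, h.eval_mask hm]
  simp only [nvar, NExpr.eval, h.power]

theorem Scan.holds_freeTest (h : Scan n k α β c B e mask d acc s) (hm : mask < 2 ^ (2 * k + 1)) :
    freeTest.holds s ↔ Free n k (n - (e + 1)) mask d := by
  simp only [freeTest, Test.holds, NExpr.eval, h.eval_row hm, h.eval_mask hm]
  simp only [nvar, NExpr.eval, h.power, h.offset, h.ready.width, h.ready.size, Free,
    Nat.le_zero]

/-- The next mask stays below the number of masks, so adding it to the base of level `e` does not
spill into another level of the table. -/
theorem half_lt (hm : mask < 2 ^ (2 * k + 1)) (hd : d < 2 * k + 1) :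
    (mask + 2 ^ d) / 2 < 2 ^ (2 * k + 1) := by
  have : 2 ^ d < 2 ^ (2 * k + 1) := Nat.pow_lt_pow_right (by norm_num) hd
  omega

theorem Scan.eval_term (h : Scan n k α β c B e mask d acc s) (hα : α ≠ 0)
    (hm : mask < 2 ^ (2 * k + 1)) (hd : d < 2 * k + 1) (hB : (e + 1) * 2 ^ (2 * k + 1) ≤ B) :
    termExpr.eval s = offsetWeight α β k d *
      bandPermanent n k (offsetWeight α β k) e ((mask + 2 ^ d) / 2) := by
  have hlt := half_lt hm hd
  have hg : gapExpr.eval s = |(d : ℝ) - k| := by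
    simp only [gapExpr, nvar, RExpr.eval, NExpr.eval, h.offset, h.ready.width]
    rcases le_total d k with h | h
    · rw [Nat.sub_eq_zero_of_le h, zero_add, Nat.cast_sub h, abs_sub_comm, abs_of_nonneg]
      exact sub_nonneg.2 (by exact_mod_cast h)
    · rw [Nat.sub_eq_zero_of_le h, add_zero, Nat.cast_sub h, abs_of_nonneg]
      exact sub_nonneg.2 (by exact_mod_cast h)
  have hw : weightExpr.eval s = offsetWeight α β k d := by
    simp only [weightExpr, RExpr.eval, NExpr.eval, hg, rvar, h.ready.exponent, h.ready.dispersion,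
      Nat.cast_zero, Nat.cast_one]
    rw [rpow_eq_mul_exp hα (abs_nonneg _), offsetWeight, cost, zero_sub, neg_mul]
  simp only [termExpr, RExpr.eval, hw, h.eval_next hm]
  -- The cell read belongs to level `e`, which lies entirely below `(e + 1) * 2 ^ (2 * k + 1) ≤ B`
  -- and is already correct.
  rw [h.table _ (by rw [Nat.succ_mul] at hB; omega), Nat.mul_add_mod_of_lt hlt, Nat.mul_comm e,
    Nat.mul_add_div (by positivity), Nat.div_eq_of_lt hlt, add_zero]

theorem TableBelow.setNat (h : TableBelow n k α β B s) {a i v : ℕ} :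
    TableBelow n k α β B (s.setNat a i v) := h

theorem TableBelow.setReal (h : TableBelow n k α β B s) {a i : ℕ} {v : ℝ} (ha : a ≠ 3) :
    TableBelow n k α β B (s.setReal a i v) := by
  intro y hy
  rw [← h y hy, State.setReal_real, if_neg fun h => ha h.1.symm]

theorem Scan.nextOffset (h : Scan n k α β c B e mask d acc s) :
    Scan n k α β c B e mask (d + 1) acc
      ((s.setNat 6 0 (d + 1)).setNat 7 0 (2 ^ (d + 1))) where
  ready := (h.ready.setNat (by norm_num)).setNat (by norm_num)
  pointer := by simp [State.setNat_nat, h.pointer]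
  offset := by simp [State.setNat_nat]
  power := by simp [State.setNat_nat]
  sum := h.sum
  table := h.table

theorem Scan.triple_nextOffset {Ω : Type} (h : Scan n k α β c B e mask d acc s)
    {Q : Ω → State → Prop} (ω : Ω)
    (hQ : Q ω ((s.setNat 6 0 (d + 1)).setNat 7 0 (2 ^ (d + 1)))) :
    Triple RealRAM.nextOffset s 3 (PMF.pure ω) Q := by
  refine Triple.setNat_seq (t := 1) (Triple.setNat ω ?_)
  simp only [nvar, NExpr.eval, State.setNat_nat, h.offset, h.power]
  convert hQ using 2
  norm_num
  ring

theorem Scan.setSum (h : Scan n k α β c B e mask d acc s) (v : ℝ) :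
    Scan n k α β c B e mask d v (s.setReal 4 0 v) where
  ready := h.ready.setReal (by norm_num)
  pointer := h.pointer
  offset := h.offset
  power := h.power
  sum := by simp [State.setReal_real]
  table := h.table.setReal (by norm_num)

theorem Scan.triple_addTerm (hα : α ≠ 0) (hm : mask < 2 ^ (2 * k + 1)) (hd : d < 2 * k + 1)
    (hB : (e + 1) * 2 ^ (2 * k + 1) ≤ B) {f : ℕ → ℝ}
    (hf : f = rowTerm n k (offsetWeight α β k) e mask)
    (h : Scan n k α β c B e mask d (∑ d' ∈ range d, f d') s) :
    Triple addTerm s 6 (PMF.pure ()) fun _ s' =>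
      Scan n k α β c B e mask (d + 1) (∑ d' ∈ range (d + 1), f d') s' := by
  refine Triple.seq_pure (t₁ := 2) (t₂ := 3) (ω := ()) (Q := fun _ s' =>
    Scan n k α β c B e mask d (∑ d' ∈ range (d + 1), f d') s') ?_
    fun s' h' => h'.triple_nextOffset () h'.nextOffset
  rw [sum_range_succ]
  by_cases hF : Free n k (n - (e + 1)) mask d
  · refine Triple.ite_true ((h.holds_freeTest hm).2 hF) (Triple.setReal () ?_)
    have : (RExpr.add (rvar 4) termExpr).eval s = ∑ d' ∈ range d, f d' + f d := by
      simp only [RExpr.eval, h.eval_term hα hm hd hB, rvar, NExpr.eval, h.sum, hf, rowTerm, if_pos hF]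
    rw [this]
    exact h.setSum _
  · refine Triple.ite_false (fun h' => hF ((h.holds_freeTest hm).1 h')) (Triple.skip () ?_)
    have : f d = 0 := by rw [hf, rowTerm, if_neg hF]
    rw [this, add_zero]
    exact h

theorem Scan.holds_offsetsLeft (h : Scan n k α β c B e mask d acc s) :
    offsetsLeft.holds s ↔ d < 2 * k + 1 := by
  simp only [offsetsLeft, Test.holds, nvar, NExpr.eval, h.offset, h.ready.width]
  omega

theorem triple_expandRow (hα : α ≠ 0) (hm : mask < 2 ^ (2 * k + 1))
    (hB : (e + 1) * 2 ^ (2 * k + 1) ≤ B) (hr : Ready n k α β c s)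
    (hx : s.nat 5 0 = (e + 1) * 2 ^ (2 * k + 1) + mask) (ht : TableBelow n k α β B s) :
    Triple expandRow s ((2 * k + 1) * 7 + 7) (PMF.pure ()) fun _ s' =>
      Scan n k α β c B e mask (2 * k + 1)
        (bandPermanent n k (offsetWeight α β k) (e + 1) mask) s' := by
  refine Triple.setReal_seq (Triple.setNat_seq (Triple.setNat_seq
    (Triple.while_det (m := 2 * k + 1) (c := 6) (fun d s' => Scan n k α β c B e mask d
      (∑ d' ∈ range d, rowTerm n k (offsetWeight α β k) e mask d') s') ?_ ?_ ?_)))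
  · intro d hd s' h
    exact ⟨h.holds_offsetsLeft.2 hd, h.triple_addTerm hα hm hd hB rfl⟩
  · intro s' h h'
    exact lt_irrefl _ (h.holds_offsetsLeft.1 h')
  · refine ⟨((hr.setReal (by norm_num)).setNat (by norm_num)).setNat (by norm_num), ?_, ?_, ?_, ?_,
      ((ht.setReal (by norm_num)).setNat).setNat⟩ <;>
    simp [State.setNat_nat, State.setReal_nat, State.setReal_real, State.setNat_real, NExpr.eval,
      RExpr.eval, hx]

theorem triple_fillCell (hα : α ≠ 0) {x : ℕ} (hr : Ready n k α β c s) (hx : s.nat 5 0 = x)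
    (ht : TableBelow n k α β x s) :
    Triple fillCell s ((2 * k + 1) * 7 + 12) (PMF.pure ()) fun _ s' =>
      Ready n k α β c s' ∧ s'.nat 5 0 = x + 1 ∧ TableBelow n k α β (x + 1) s' := by
  refine Triple.mono (Triple.seq_pure (t₁ := (2 * k + 1) * 7 + 8) (t₂ := 3) (ω := ())
    (Q := fun _ s' => Ready n k α β c s' ∧ s'.nat 5 0 = x ∧ TableBelow n k α β x s' ∧
      s'.real 4 0 = bandPermanent n k (offsetWeight α β k) (x / 2 ^ (2 * k + 1))
        (x % 2 ^ (2 * k + 1))) ?_ ?_) (by omega) fun _ _ h => h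
  · have hpos : 0 < 2 ^ (2 * k + 1) := by positivity
    by_cases hlt : 2 ^ (2 * k + 1) ≤ x
    · refine Triple.ite_true ?_ ?_
      · simpa only [Test.holds, nvar, NExpr.eval, hr.masks, hx] using hlt
      · obtain ⟨e, he⟩ : ∃ e, x / 2 ^ (2 * k + 1) = e + 1 :=
          ⟨_, (Nat.succ_pred_eq_of_pos (Nat.div_pos hlt hpos)).symm⟩
        have hdm : (e + 1) * 2 ^ (2 * k + 1) + x % 2 ^ (2 * k + 1) = x := by
          rw [← he]; exact Nat.div_add_mod' _ _
        rw [he]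
        refine (triple_expandRow (e := e) hα (Nat.mod_lt x hpos) (by omega) hr
          (by rw [hdm, hx]) ht).mono le_rfl fun _ s' h => ⟨h.ready, ?_, h.table, h.sum⟩
        rw [h.pointer, hdm]
    -- The cells of level `0` have no rows left, and the empty permanent is `1`.
    · refine (Triple.ite_false ?_ (Triple.setReal () ?_)).mono (by omega) fun _ _ h => h
      · simpa only [Test.holds, nvar, NExpr.eval, hr.masks, hx] using hlt
      · refine ⟨hr.setReal (by norm_num), hx, ht.setReal (by norm_num), ?_⟩
        rw [Nat.div_eq_of_lt (not_le.1 hlt)]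
        simp [State.setReal_real, NExpr.eval, RExpr.eval, bandPermanent]
  · rintro s' ⟨h1, h2, h3, h4⟩
    refine Triple.setReal_seq (t := 1) (Triple.setNat () ?_)
    refine ⟨(h1.setReal (by norm_num)).setNat (by norm_num), ?_, ?_⟩
    · simp [State.setNat_nat, State.setReal_nat, NExpr.eval, nvar, h2]
    · refine TableBelow.setNat fun y hy => ?_
      simp only [nvar, rvar, NExpr.eval, RExpr.eval, State.setReal_real, h2, true_and]
      split_ifs with hyx
      · rw [hyx, h4]
      · exact h3 y (by omega)

theorem triple_fillTable (hα : α ≠ 0) (hr : Ready n k α β c s) :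
    Triple fillTable s ((n + 1) * 2 ^ (2 * k + 1) * ((2 * k + 1) * 7 + 13) + 3) (PMF.pure ())
      fun _ s' => Ready n k α β c s' ∧ s'.nat 5 0 = (n + 1) * 2 ^ (2 * k + 1) ∧
        TableBelow n k α β ((n + 1) * 2 ^ (2 * k + 1)) s' := by
  have hpos : 0 < 2 ^ (2 * k + 1) := by positivity
  -- The loop compares a quotient with `n` because the bound `(n + 1) * 2 ^ (2 * k + 1)` is never
  -- computed.
  have htest : ∀ x s', Ready n k α β c s' → s'.nat 5 0 = x →
      ((Test.natLe (.div (nvar 5) (nvar 4)) (nvar 0)).holds s' ↔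
        x < (n + 1) * 2 ^ (2 * k + 1)) := by
    intro x s' h hx
    simp only [Test.holds, nvar, NExpr.eval, h.masks, hx, h.size]
    rw [← Nat.div_lt_iff_lt_mul hpos, Nat.lt_succ_iff]
  refine Triple.setNat_seq (Triple.while_det (m := (n + 1) * 2 ^ (2 * k + 1))
    (c := (2 * k + 1) * 7 + 12) (fun x s' => Ready n k α β c s' ∧ s'.nat 5 0 = x ∧
      TableBelow n k α β x s') ?_ ?_ ?_)
  · rintro x hx s' ⟨h1, h2, h3⟩
    exact ⟨(htest x s' h1 h2).2 hx, triple_fillCell hα h1 h2 h3⟩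
  · rintro s' ⟨h1, h2, _⟩ h
    exact lt_irrefl _ ((htest _ s' h1 h2).1 h)
  · refine ⟨hr.setNat (by norm_num), ?_, fun y hy => by omega⟩
    simp [State.setNat_nat, NExpr.eval]

end RealRAM

/-! ### The sampling program -/

namespace RealRAM

open Mallows Finset

/-- Selection of the column with the current offset, with the probability that reservoir sampling
prescribes. -/
def offerOffset : Prog :=
  .seq (.ite freeTest
      (.seq (.setReal 5 (.const 0) termExpr)
        (.seq (.setReal 4 (.const 0) (.add (rvar 4) (rvar 5)))
          (.flip (.div (rvar 5) (rvar 4))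
            (.seq (.setNat 8 (.const 0) nextExpr)
              (.setNat 9 (.const 0) (.sub (.add rowExpr (nvar 6)) (nvar 3))))
            .skip)))
      .skip)
    nextOffset

/-- Random choice of the column of one row. -/
def sampleRow : Prog :=
  .seq (.setReal 4 (.const 0) (.ofNat (.const 0)))
    (.seq (.setNat 6 (.const 0) (.const 0))
      (.seq (.setNat 7 (.const 0) (.const 1))
        (.seq (.setNat 8 (.const 0) nextBase)
          (.seq (.setNat 9 (.const 0) (.const 0))
            (.while offsetsLeft offerOffset)))))

/-- The column has to be stored before the pointer moves, since `rowExpr` is read off from the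
pointer. -/
def sampleAndStore : Prog :=
  .seq sampleRow (.seq (.setNat 10 rowExpr (nvar 9)) (.setNat 5 (.const 0) (nvar 8)))

/-- Random choice of the columns of all rows. -/
def sampleRows : Prog :=
  .seq (.setNat 5 (.const 0) (.sub (nvar 5) (nvar 4)))
    (.while (.natLe (nvar 4) (nvar 5)) sampleAndStore)

/-- Composition of the sampled permutation with the central ranking. -/
def writeOutput : Prog :=
  .seq (.setNat 11 (.const 0) (.const 0))
    (.while (.natLe (.add (nvar 11) (.const 1)) (nvar 0))
      (.seq (.setNat 2 (nvar 11) (.load 10 (.load 1 (nvar 11))))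
        (.setNat 11 (.const 0) (.add (nvar 11) (.const 1)))))

variable {n k : ℕ} {α β : ℝ} {c : ℕ → ℕ} {s : State} {B e mask d : ℕ} {acc : ℝ}

/-- The row is being scanned, with `ω` the current choice of the next mask and of the column. -/
structure Offer (n k : ℕ) (α β : ℝ) (c : ℕ → ℕ) (B e mask d : ℕ) (acc : ℝ) (g : ℕ → ℕ) (ω : ℕ × ℕ)
    (s : State) : Prop where
  scan : Scan n k α β c B e mask d acc s
  next : s.nat 8 0 = e * 2 ^ (2 * k + 1) + ω.1
  lt : ω.1 < 2 ^ (2 * k + 1)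
  column : s.nat 9 0 = ω.2
  columns : s.nat 10 = g

variable {g : ℕ → ℕ} {ω : ℕ × ℕ}

theorem Offer.nextOffset (h : Offer n k α β c B e mask d acc g ω s) :
    Offer n k α β c B e mask (d + 1) acc g ω
      ((s.setNat 6 0 (d + 1)).setNat 7 0 (2 ^ (d + 1))) where
  scan := h.scan.nextOffset
  next := by simp [State.setNat_nat, h.next]
  lt := h.lt
  column := by simp [State.setNat_nat, h.column]
  columns := by rw [← h.columns]; funext i; simp [State.setNat_nat]

theorem Offer.setSum (h : Offer n k α β c B e mask d acc g ω s) (u v : ℝ) :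
    Offer n k α β c B e mask d v g ω ((s.setReal 5 0 u).setReal 4 0 v) where
  scan := by
    have : Scan n k α β c B e mask d acc (s.setReal 5 0 u) :=
      ⟨h.scan.ready.setReal (by norm_num), h.scan.pointer, h.scan.offset, h.scan.power,
        by simp [State.setReal_real, h.scan.sum], h.scan.table.setReal (by norm_num)⟩
    exact this.setSum v
  next := h.next
  lt := h.lt
  column := h.column
  columns := h.columns

theorem Offer.choose (h : Offer n k α β c B e mask d acc g ω s) (ω' : ℕ × ℕ)
    (hω' : ω'.1 < 2 ^ (2 * k + 1)) :
    Offer n k α β c B e mask d acc g ω'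
      ((s.setNat 8 0 (e * 2 ^ (2 * k + 1) + ω'.1)).setNat 9 0 ω'.2) where
  scan := ⟨(h.scan.ready.setNat (by norm_num)).setNat (by norm_num),
    by simp [State.setNat_nat, h.scan.pointer], by simp [State.setNat_nat, h.scan.offset],
    by simp [State.setNat_nat, h.scan.power], h.scan.sum, h.scan.table⟩
  next := by simp [State.setNat_nat]
  lt := hω'
  column := by simp [State.setNat_nat]
  columns := by rw [← h.columns]; funext i; simp [State.setNat_nat]

theorem Offer.triple_offerOffset (hα : α ≠ 0) (hm : mask < 2 ^ (2 * k + 1)) (hd : d < 2 * k + 1)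
    (hB : (e + 1) * 2 ^ (2 * k + 1) ≤ B)
    (h : Offer n k α β c B e mask d
      (∑ d' ∈ range d, rowTerm n k (offsetWeight α β k) e mask d') g ω s) :
    Triple offerOffset s 13 (rowStep n k (offsetWeight α β k) e mask d ω)
      (Offer n k α β c B e mask (d + 1)
        (∑ d' ∈ range (d + 1), rowTerm n k (offsetWeight α β k) e mask d') g) := by
  have key : Triple (.ite freeTest
      (.seq (.setReal 5 (.const 0) termExpr)
        (.seq (.setReal 4 (.const 0) (.add (rvar 4) (rvar 5)))
          (.flip (.div (rvar 5) (rvar 4))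
            (.seq (.setNat 8 (.const 0) nextExpr)
              (.setNat 9 (.const 0) (.sub (.add rowExpr (nvar 6)) (nvar 3))))
            .skip)))
      .skip) s 9 (rowStep n k (offsetWeight α β k) e mask d ω)
      (Offer n k α β c B e mask d
        (∑ d' ∈ range (d + 1), rowTerm n k (offsetWeight α β k) e mask d') g) := by
    by_cases hF : Free n k (n - (e + 1)) mask d
    · rw [rowStep, reservoirStep, if_pos hF]
      refine Triple.ite_true ((h.scan.holds_freeTest hm).2 hF)
        (Triple.setReal_seq (Triple.setReal_seq ?_))
      have hterm : termExpr.eval s = rowTerm n k (offsetWeight α β k) e mask d := by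
        rw [h.scan.eval_term hα hm hd hB, rowTerm, if_pos hF]
      rw [hterm]
      set u := rowTerm n k (offsetWeight α β k) e mask d with hu
      have hsum : (RExpr.add (rvar 4) (rvar 5)).eval
          (s.setReal 5 ((NExpr.const 0).eval s) u) =
            ∑ d' ∈ range (d + 1), rowTerm n k (offsetWeight α β k) e mask d' := by
        rw [sum_range_succ, ← hu]
        simp [RExpr.eval, rvar, NExpr.eval, State.setReal_real, h.scan.sum]
      rw [hsum]
      simp only [NExpr.eval]
      set v := ∑ d' ∈ range (d + 1), rowTerm n k (offsetWeight α β k) e mask d' with hv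
      have h' := h.setSum u v
      have hx : (RExpr.div (rvar 5) (rvar 4)).eval ((s.setReal 5 0 u).setReal 4 0 v) = u / v := by
        simp [RExpr.eval, rvar, NExpr.eval, State.setReal_real]
      rw [← hx]
      refine Triple.flip (t := 3) ?_ ((Triple.skip ω h').mono (by norm_num) fun _ _ h => h)
      refine Triple.setNat_seq (t := 1) (Triple.setNat _ ?_)
      have hc := h'.choose ((mask + 2 ^ d) / 2, n - (e + 1) + d - k) (half_lt hm hd)
      have e1 := h'.scan.eval_next hm
      have e2 : (NExpr.sub (.add rowExpr (nvar 6)) (nvar 3)).eval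
          (((s.setReal 5 0 u).setReal 4 0 v).setNat 8 0 (e * 2 ^ (2 * k + 1) + (mask + 2 ^ d) / 2)) =
            n - (e + 1) + d - k := by
        have e3 := h'.scan.eval_row hm
        have e4 := h'.scan.offset
        have e5 := h'.scan.ready.width
        simp only [rowExpr, nvar, NExpr.eval, State.setNat_nat] at e3 e4 e5 ⊢
        norm_num
        rw [e3, e4, e5]
      rw [e1]
      simp only [NExpr.eval] at e2 ⊢
      rw [e2]
      exact hc
    · rw [rowStep, reservoirStep, if_neg hF]
      refine (Triple.ite_false (fun h' => hF ((h.scan.holds_freeTest hm).1 h'))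
        (Triple.skip ω ?_)).mono (by norm_num) fun _ _ h => h
      rw [sum_range_succ, rowTerm, if_neg hF, add_zero]
      exact h
  have := key.seq (κ := PMF.pure) fun ω s' h => h.scan.triple_nextOffset ω h.nextOffset
  rwa [PMF.bind_pure] at this

/-- The first `j` rows are sampled, `ω` consists of the current mask and of the columns. -/
structure Sampled (n k : ℕ) (α β : ℝ) (c : ℕ → ℕ) (j : ℕ) (ω : ℕ × (ℕ → ℕ)) (s : State) :
    Prop where
  ready : Ready n k α β c s
  pointer : s.nat 5 0 = (n - j) * 2 ^ (2 * k + 1) + ω.1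
  lt : ω.1 < 2 ^ (2 * k + 1)
  columns : s.nat 10 = ω.2
  table : TableBelow n k α β ((n + 1) * 2 ^ (2 * k + 1)) s

theorem triple_sampleRow (hα : α ≠ 0) (hm : mask < 2 ^ (2 * k + 1))
    (hB : (e + 1) * 2 ^ (2 * k + 1) ≤ B) (hr : Ready n k α β c s)
    (hx : s.nat 5 0 = (e + 1) * 2 ^ (2 * k + 1) + mask) (ht : TableBelow n k α β B s)
    (hg : s.nat 10 = g) :
    Triple sampleRow s ((2 * k + 1) * 14 + 11)
      (chain (rowStep n k (offsetWeight α β k) e mask) 0 (2 * k + 1) (0, 0))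
      (Offer n k α β c B e mask (2 * k + 1)
        (∑ d' ∈ range (2 * k + 1), rowTerm n k (offsetWeight α β k) e mask d') g) := by
  refine Triple.setReal_seq (Triple.setNat_seq (Triple.setNat_seq (Triple.setNat_seq
    (Triple.setNat_seq (Triple.while_loop (m := 2 * k + 1) (c := 13) (fun d => Offer n k α β c B e
      mask d (∑ d' ∈ range d, rowTerm n k (offsetWeight α β k) e mask d') g) _ ?_ ?_ ?_)))))
  · intro d hd ω s' h
    exact ⟨h.scan.holds_offsetsLeft.2 hd, h.triple_offerOffset hα hm hd hB⟩
  · intro ω s' h h'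
    exact lt_irrefl _ (h.scan.holds_offsetsLeft.1 h')
  · simp only [NExpr.eval, RExpr.eval]
    have h0 : Scan n k α β c B e mask 0 0
        (((s.setReal 4 0 ((0 : ℕ) : ℝ)).setNat 6 0 0).setNat 7 0 1) := by
      refine ⟨((hr.setReal (by norm_num)).setNat (by norm_num)).setNat (by norm_num), ?_, ?_, ?_,
        ?_, ((ht.setReal (by norm_num)).setNat).setNat⟩ <;>
      simp [State.setNat_nat, State.setReal_nat, State.setReal_real, State.setNat_real, hx]
    rw [h0.eval_nextBase hm]
    have h1 : Offer n k α β c B e mask 0 0 g (0, 0)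
        (((((s.setReal 4 0 ((0 : ℕ) : ℝ)).setNat 6 0 0).setNat 7 0 1).setNat 8 0
          (e * 2 ^ (2 * k + 1))).setNat 9 0 0) := by
      refine ⟨⟨(h0.ready.setNat (by norm_num)).setNat (by norm_num), ?_, ?_, ?_, ?_,
        h0.table⟩, ?_, ?_, ?_, ?_⟩
      · simpa [State.setNat_nat] using h0.pointer
      · simp [State.setNat_nat]
      · simp [State.setNat_nat]
      · exact h0.sum
      · simp [State.setNat_nat]
      · positivity
      · simp [State.setNat_nat]
      · rw [← hg]; funext i; simp [State.setNat_nat, State.setReal_nat]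
    simpa using h1

theorem Sampled.triple_sampleAndStore (hα : α ≠ 0) {j : ℕ} (hj : j < n) {ω : ℕ × (ℕ → ℕ)}
    (h : Sampled n k α β c j ω s) :
    Triple sampleAndStore s ((2 * k + 1) * 14 + 15) (sampleStep n k (offsetWeight α β k) j ω)
      (Sampled n k α β c (j + 1)) := by
  obtain ⟨e, he⟩ : ∃ e, n - j = e + 1 := ⟨n - j - 1, by omega⟩
  have hej : e = n - (j + 1) := by omega
  have h1 := triple_sampleRow hα (e := e) (B := (n + 1) * 2 ^ (2 * k + 1)) h.lt
    (Nat.mul_le_mul_right _ (by omega)) h.ready (by rw [h.pointer, he]) h.table h.columns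
  rw [sampleStep, ← hej]
  refine h1.seq (t₂ := 3) (κ := fun x => PMF.pure (x.1, Function.update ω.2 j x.2))
    (R := Sampled n k α β c (j + 1)) fun x s' h' => ?_
  refine Triple.setNat_seq (t := 1) (Triple.setNat _ ?_)
  rw [h'.scan.eval_row h.lt, show n - (e + 1) = j by omega]
  simp only [nvar, NExpr.eval]
  refine ⟨(h'.scan.ready.setNat (by norm_num)).setNat (by norm_num), ?_, h'.lt, ?_, h'.scan.table⟩
  · simp [State.setNat_nat, h'.next, hej]
  · funext i
    simp [State.setNat_nat, h'.column, h'.columns, Function.update_apply]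

/-- The pointer left just behind the table is lowered by one level, to the cell of all `n` rows with
the empty mask. Every row lowers it by one more level, and after `n` rows only a mask remains, which
fails the test. -/
theorem triple_sampleRows (hα : α ≠ 0) (hr : Ready n k α β c s)
    (hx : s.nat 5 0 = (n + 1) * 2 ^ (2 * k + 1))
    (ht : TableBelow n k α β ((n + 1) * 2 ^ (2 * k + 1)) s) :
    Triple sampleRows s (n * ((2 * k + 1) * 14 + 16) + 3)
      (chain (sampleStep n k (offsetWeight α β k)) 0 n (0, s.nat 10)) (Sampled n k α β c n) := by
  have hpos : 0 < 2 ^ (2 * k + 1) := by positivity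
  refine Triple.setNat_seq (Triple.while_loop (m := n) (c := (2 * k + 1) * 14 + 15)
    (Sampled n k α β c) _ ?_ ?_ ?_)
  · intro j hj ω s' h
    refine ⟨?_, h.triple_sampleAndStore hα hj⟩
    simp only [Test.holds, nvar, NExpr.eval, h.ready.masks, h.pointer]
    have := Nat.mul_le_mul_right (2 ^ (2 * k + 1)) (show 1 ≤ n - j by omega)
    omega
  · intro ω s' h
    simp only [Test.holds, nvar, NExpr.eval, h.ready.masks, h.pointer]
    have := h.lt
    simpa using this
  · refine ⟨hr.setNat (by norm_num), ?_, hpos, ?_, ht⟩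
    · simp only [State.setNat_nat, nvar, NExpr.eval, hx, hr.masks]
      rw [Nat.succ_mul]
      simp
    · funext i; simp [State.setNat_nat]

theorem triple_writeOutput {ω : ℕ × (ℕ → ℕ)} (h : Sampled n k α β c n ω s) :
    Triple writeOutput s (n * 4 + 3) (PMF.pure ω) fun ω s' => ∀ i < n, s'.nat 2 i = ω.2 (c i) := by
  let I : ℕ → ℕ × (ℕ → ℕ) → State → Prop := fun j ω s' =>
    s'.nat 0 0 = n ∧ s'.nat 1 = c ∧ s'.nat 10 = ω.2 ∧ s'.nat 11 0 = j ∧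
      ∀ i < j, s'.nat 2 i = ω.2 (c i)
  have hloop : Triple writeOutput s (n * 4 + 3) (chain (fun _ ω => PMF.pure ω) 0 n ω) (I n) := by
    refine Triple.setNat_seq (Triple.while_loop (m := n) (c := 3) I _ ?_ ?_ ?_)
    · rintro j hj ω s' ⟨h1, h2, h3, h4, h5⟩
      refine ⟨?_, Triple.setNat_seq (t := 1) (Triple.setNat ω ⟨?_, ?_, ?_, ?_, ?_⟩)⟩
      · simp only [Test.holds, nvar, NExpr.eval, h1, h4]
        omega
      · simp [State.setNat_nat, h1]
      · rw [← h2]; funext i; simp [State.setNat_nat]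
      · rw [← h3]; funext i; simp [State.setNat_nat]
      · simp [State.setNat_nat, NExpr.eval, nvar, h4]
      · intro i hi
        simp only [State.setNat_nat, NExpr.eval, nvar, h4, h2, h3]
        by_cases hij : i = j
        · simp [hij]
        · simpa [hij] using h5 i (by omega)
    · rintro ω s' ⟨h1, _, _, h4, _⟩
      simp only [Test.holds, nvar, NExpr.eval, h1, h4]
      omega
    · refine ⟨?_, ?_, ?_, ?_, fun i hi => by omega⟩
      · simp [State.setNat_nat, h.ready.size]
      · rw [← h.ready.center]; funext i; simp [State.setNat_nat]
      · rw [← h.columns]; funext i; simp [State.setNat_nat]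
      · simp [State.setNat_nat, NExpr.eval]
  rw [chain_pure (fun _ ω => ω) ω fun _ => rfl] at hloop
  exact hloop.mono le_rfl fun ω s' h => h.2.2.2.2

end RealRAM

/-! ### The half-width, the complete programs and their running time -/

namespace RealRAM

open Mallows Finset

theorem Triple.map {Ω Ω' : Type} {p : Prog} {s : State} {t : ℕ} {μ : PMF Ω}
    {Q : Ω → State → Prop} (h : Triple p s t μ Q) (f : Ω → Ω') {Q' : Ω' → State → Prop}
    (hQ : ∀ ω s', Q ω s' → Q' (f ω) s') : Triple p s t (μ.map f) Q' := by
  obtain ⟨ξ, h1, h2, h3⟩ := h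
  refine ⟨ξ.map fun x => (f x.1, x.2), ?_, ?_, fun r N => ?_⟩
  · rw [← h1, PMF.map_comp, PMF.map_comp]; rfl
  · intro x hx
    rw [PMF.mem_support_map_iff] at hx
    obtain ⟨y, hy, rfl⟩ := hx
    exact hQ _ _ (h2 y hy)
  · rw [h3, PMF.bind_map]; rfl

theorem exists_le_two_pow (x : ℝ) : ∃ t : ℕ, x ≤ 2 ^ t := by
  obtain ⟨t, ht⟩ := pow_unbounded_of_one_lt x (one_lt_two)
  exact ⟨t, ht.le⟩

open Classical in
/-- The least exponent `t` with `x ≤ 2 ^ t`. -/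
noncomputable def doublings (x : ℝ) : ℕ := Nat.find (exists_le_two_pow x)

theorem le_two_pow_doublings (x : ℝ) : x ≤ 2 ^ doublings x := by
  classical
  exact Nat.find_spec (exists_le_two_pow x)

theorem two_pow_lt_of_lt_doublings {x : ℝ} {j : ℕ} (hj : j < doublings x) : 2 ^ j < x := by
  classical
  exact not_le.1 (Nat.find_min (exists_le_two_pow x) hj)

theorem two_pow_doublings_le {x : ℝ} (hx : 1 ≤ x) : 2 ^ doublings x ≤ 2 * x := by
  rcases Nat.eq_zero_or_pos (doublings x) with h | h
  · rw [h]; linarith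
  · have := two_pow_lt_of_lt_doublings (x := x) (j := doublings x - 1) (by omega)
    rw [← Nat.succ_pred_eq_of_pos h, pow_succ]
    simp only [Nat.pred_eq_sub_one]
    linarith

/-- The band half-width that the programs use. -/
noncomputable def halfWidth (K n : ℕ) (ε : ℝ) : ℕ := K * (doublings (1 + n / ε) + 1)

/-- Computation of the half-width. -/
def findWidth (K : ℕ) : Prog :=
  .seq (.setReal 2 (.const 0) (.ofNat (.const 1)))
    (.seq (.setNat 3 (.const 0) (.const K))
      (.while (.not (.realLe (.add (.ofNat (.const 1)) (.div (.ofNat (nvar 0)) (.load 0 (.const 2))))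
          (rvar 2)))
        (.seq (.setReal 2 (.const 0) (.add (rvar 2) (rvar 2)))
          (.setNat 3 (.const 0) (.add (nvar 3) (.const K))))))

/-- Computation of the number of masks. -/
def countMasks : Prog :=
  .seq (.setNat 4 (.const 0) (.const 1))
    (.seq (.setNat 5 (.const 0) (.const 0))
      (.while (.natLe (.add (nvar 5) (.const 1)) (.add (.add (nvar 3) (nvar 3)) (.const 1)))
        (.seq (.setNat 4 (.const 0) (.add (nvar 4) (nvar 4)))
          (.setNat 5 (.const 0) (.add (nvar 5) (.const 1))))))

def prepare (K : ℕ) : Prog := .seq (findWidth K) (.seq countMasks fillTable)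

/-- The program that returns the permanent of the band matrix. -/
def estimatorProg (K : ℕ) : Prog :=
  .seq (prepare K) (.setReal 1 (.const 0) (.load 3 (.sub (nvar 5) (nvar 4))))

/-- The program that samples from the truncated Mallows distribution. -/
def samplerProg (K : ℕ) : Prog := .seq (prepare K) (.seq sampleRows writeOutput)

theorem estimatorProg_deterministic (K : ℕ) : (estimatorProg K).Deterministic := by
  simp [estimatorProg, prepare, findWidth, countMasks, fillTable, fillCell, expandRow, addTerm,
    nextOffset, Prog.Deterministic]

/-- The input. -/
structure Start (n : ℕ) (α β ε : ℝ) (c : ℕ → ℕ) (s : State) : Prop where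
  size : s.nat 0 0 = n
  exponent : s.real 0 0 = α
  dispersion : s.real 0 1 = β
  accuracy : s.real 0 2 = ε
  center : s.nat 1 = c

variable {n k : ℕ} {α β ε : ℝ} {c : ℕ → ℕ} {s : State}

theorem Start.setNat (h : Start n α β ε c s) {a i v : ℕ} (ha : 1 < a) :
    Start n α β ε c (s.setNat a i v) := by
  obtain ⟨h1, h2, h3, h4, h5⟩ := h
  refine ⟨?_, h2, h3, h4, ?_⟩ <;>
  · simp only [State.setNat]
    rw [Function.update_of_ne (by omega)]
    assumption

theorem Start.setReal (h : Start n α β ε c s) {a i : ℕ} {v : ℝ} (ha : 0 < a) :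
    Start n α β ε c (s.setReal a i v) := by
  obtain ⟨h1, h2, h3, h4, h5⟩ := h
  refine ⟨h1, ?_, ?_, ?_, h5⟩ <;>
  · simp only [State.setReal]
    rw [Function.update_of_ne (by omega)]
    assumption

theorem triple_findWidth (K : ℕ) (h : Start n α β ε c s) :
    Triple (findWidth K) s (doublings (1 + n / ε) * 4 + 5) (PMF.pure ()) fun _ s' =>
      Start n α β ε c s' ∧ s'.nat 3 0 = halfWidth K n ε := by
  have htest : ∀ j s', Start n α β ε c s' → s'.real 2 0 = 2 ^ j →
      ((Test.not (.realLe (.add (.ofNat (.const 1)) (.div (.ofNat (nvar 0)) (.load 0 (.const 2))))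
          (rvar 2))).holds s' ↔ ¬ (1 + n / ε : ℝ) ≤ 2 ^ j) := by
    intro j s' h' hj
    simp [Test.holds, RExpr.eval, NExpr.eval, nvar, rvar, h'.size, h'.accuracy, hj]
  refine Triple.mono (Triple.setReal_seq (Triple.setNat_seq (Triple.while_det
    (m := doublings (1 + n / ε)) (c := 3) (fun j s' => Start n α β ε c s' ∧ s'.real 2 0 = 2 ^ j ∧
      s'.nat 3 0 = K * (j + 1)) ?_ ?_ ?_))) le_rfl fun _ s' h => ⟨h.1, h.2.2⟩
  · rintro j hj s' ⟨h1, h2, h3⟩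
    refine ⟨(htest j s' h1 h2).2 (not_le.2 (two_pow_lt_of_lt_doublings hj)),
      Triple.setReal_seq (t := 1) (Triple.setNat ()
        ⟨(h1.setReal (by norm_num)).setNat (by norm_num), ?_, ?_⟩)⟩
    · simp [State.setNat_real, State.setReal_real, RExpr.eval, NExpr.eval, rvar, h2]
      ring
    · simp [State.setNat_nat, State.setReal_nat, NExpr.eval, nvar, h3]
      ring
  · rintro s' ⟨h1, h2, _⟩ h'
    exact (htest _ s' h1 h2).1 h' (le_two_pow_doublings _)
  · refine ⟨(h.setReal (by norm_num)).setNat (by norm_num), ?_, ?_⟩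
    · simp [State.setNat_real, State.setReal_real, RExpr.eval, NExpr.eval]
    · simp [State.setNat_nat, NExpr.eval]

theorem triple_countMasks (h : Start n α β ε c s) (hk : s.nat 3 0 = k) :
    Triple countMasks s ((2 * k + 1) * 4 + 5) (PMF.pure ()) fun _ s' => Ready n k α β c s' := by
  refine Triple.mono (Triple.setNat_seq (Triple.setNat_seq (Triple.while_det
    (m := 2 * k + 1) (c := 3) (fun j s' => Start n α β ε c s' ∧ s'.nat 3 0 = k ∧
      s'.nat 4 0 = 2 ^ j ∧ s'.nat 5 0 = j) ?_ ?_ ?_))) le_rfl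
      fun _ s' h => ⟨h.1.size, h.2.1, h.2.2.1, h.1.exponent, h.1.dispersion, h.1.center⟩
  · rintro j hj s' ⟨h1, h2, h3, h4⟩
    refine ⟨?_, Triple.setNat_seq (t := 1) (Triple.setNat ()
      ⟨(h1.setNat (by norm_num)).setNat (by norm_num), ?_, ?_, ?_⟩)⟩
    · simp only [Test.holds, nvar, NExpr.eval, h2, h4]
      omega
    · simp [State.setNat_nat, h2]
    · simp [State.setNat_nat, NExpr.eval, nvar, h3]
      ring
    · simp [State.setNat_nat, NExpr.eval, nvar, h4]
  · rintro s' ⟨_, h2, _, h4⟩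
    simp only [Test.holds, nvar, NExpr.eval, h2, h4]
    omega
  · refine ⟨(h.setNat (by norm_num)).setNat (by norm_num), ?_, ?_, ?_⟩ <;>
    simp [State.setNat_nat, NExpr.eval, hk]

/-- Bound for the running time, with `t` doublings and half-width `k`. -/
def runningTime (n k t : ℕ) : ℕ :=
  (t * 4 + 5) + ((2 * k + 1) * 4 + 5) + ((n + 1) * 2 ^ (2 * k + 1) * ((2 * k + 1) * 7 + 13) + 3) +
    (n * ((2 * k + 1) * 14 + 16) + 3) + (n * 4 + 3) + 4

theorem triple_prepare (K : ℕ) (hα : α ≠ 0) (h : Start n α β ε c s) (hk : k = halfWidth K n ε) :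
    Triple (prepare K) s ((doublings (1 + n / ε) * 4 + 5) + ((2 * k + 1) * 4 + 5) +
        ((n + 1) * 2 ^ (2 * k + 1) * ((2 * k + 1) * 7 + 13) + 3) + 2) (PMF.pure ())
      fun _ s' => Ready n k α β c s' ∧ s'.nat 5 0 = (n + 1) * 2 ^ (2 * k + 1) ∧
        TableBelow n k α β ((n + 1) * 2 ^ (2 * k + 1)) s' := by
  subst hk
  refine (Triple.seq_pure (triple_findWidth K h) fun s₁ h₁ =>
    Triple.seq_pure (triple_countMasks h₁.1 h₁.2) fun s₂ h₂ => triple_fillTable hα h₂).mono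
      (by omega) fun _ _ h => h

theorem triple_estimatorProg (K : ℕ) (hα : α ≠ 0) (h : Start n α β ε c s)
    (hk : k = halfWidth K n ε) :
    Triple (estimatorProg K) s (runningTime n k (doublings (1 + n / ε))) (PMF.pure ()) fun _ s' =>
      s'.realOutput = (bandMatrix n α β k).permanent := by
  refine (Triple.seq_pure (t₂ := 1) (triple_prepare K hα h hk) fun s' h' => ?_).mono
    (by unfold runningTime; omega) fun _ _ h => h
  obtain ⟨h1, h2, h3⟩ := h'
  refine Triple.setReal () ?_
  have hpos : 0 < 2 ^ (2 * k + 1) := by positivity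
  -- One level below the end of the table lies the cell for all `n` rows with no column used.
  have hidx : (NExpr.sub (nvar 5) (nvar 4)).eval s' = n * 2 ^ (2 * k + 1) := by
    simp only [nvar, NExpr.eval, h1.masks, h2]
    rw [Nat.succ_mul, Nat.add_sub_cancel]
  have := h3 (n * 2 ^ (2 * k + 1)) (Nat.mul_lt_mul_of_pos_right n.lt_succ_self hpos)
  rw [Nat.mul_div_cancel _ hpos, Nat.mul_mod_left, bandPermanent_eq_permanent] at this
  simp only [State.realOutput, RExpr.eval, hidx, this]
  simp [State.setReal_real, NExpr.eval]

theorem triple_samplerProg (K : ℕ) (hα : α ≠ 0) (σ : Equiv.Perm (Fin n))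
    (h : Start n α β ε c s) (hc : ∀ i : Fin n, c i = σ i) (hk : k = halfWidth K n ε) :
    Triple (samplerProg K) s (runningTime n k (doublings (1 + n / ε)))
      ((truncatedMallows α β k σ).map values) fun v s' => s'.listOutput n = v := by
  refine (Triple.seq_pure (t₂ := (n * ((2 * k + 1) * 14 + 16) + 3) + (n * 4 + 3) + 1)
    (triple_prepare K hα h hk) fun s' h' => ?_).mono
    (by unfold runningTime; omega) fun _ _ h => h
  have h1 := (triple_sampleRows hα h'.1 h'.2.1 h'.2.2).seq (κ := PMF.pure)
    fun ω s'' h'' => triple_writeOutput h''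
  rw [PMF.bind_pure] at h1
  rw [← chain_sampleStep_map α β k σ (s'.nat 10)]
  refine h1.map _ fun ω s'' h'' => ?_
  funext i
  rw [State.listOutput, h'' i i.2, hc]

theorem start_input (n : ℕ) (α β ε : ℝ) : Start n α β ε (fun _ => 0) (input n α β ε) := by
  constructor <;> simp [input]

theorem start_inputWithCenter (α β ε : ℝ) (σ : Equiv.Perm (Fin n)) :
    Start n α β ε (fun i => if h : i < n then (σ ⟨i, h⟩ : ℕ) else 0)
      (inputWithCenter α β ε σ) := by
  constructor <;> simp [inputWithCenter, input]

theorem runningTime_le (n k t : ℕ) :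
    runningTime n k t ≤ 100 * ((n + 1) * 2 ^ (2 * k + 1) * 2 ^ (2 * k + 1)) + 4 * 2 ^ t := by
  have ht : t < 2 ^ t := Nat.lt_two_pow_self
  have hw : 2 * k + 1 < 2 ^ (2 * k + 1) := Nat.lt_two_pow_self
  have hP : 1 ≤ 2 ^ (2 * k + 1) := Nat.one_le_two_pow
  unfold runningTime
  set w := 2 * k + 1
  set P := 2 ^ w
  nlinarith [Nat.mul_le_mul_left ((n + 1) * P) hw.le, Nat.mul_le_mul_left n hw.le,
    Nat.mul_le_mul_left ((n + 1) * P) hP, Nat.mul_le_mul_left n hP]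

theorem halfWidth_le (K n : ℕ) {ε : ℝ} (hε : 0 < ε) :
    (halfWidth K n ε : ℝ) ≤ (2 * K : ℝ) * (1 + Real.log (1 + n / ε)) := by
  have hx : (1 : ℝ) ≤ 1 + n / ε := le_add_of_nonneg_right (by positivity)
  have h := Real.log_le_log (by positivity) (two_pow_doublings_le hx)
  rw [Real.log_pow, Real.log_mul (by norm_num) (by positivity)] at h
  have h2 := Real.log_two_gt_d9
  have hlog := Real.log_nonneg hx
  have ht : (0 : ℝ) ≤ doublings (1 + n / ε) := Nat.cast_nonneg _
  -- Minimality gives `2 ^ t ≤ 2 * x`, so `(t - 1) * log 2 ≤ log x`; the factor `2` comes from `log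
  -- 2 > 1 / 2`.
  have : (doublings (1 + n / ε) : ℝ) + 1 ≤ 2 * (1 + Real.log (1 + n / ε)) := by
    rcases Nat.eq_zero_or_pos (doublings (1 + n / ε)) with h0 | h0
    · rw [h0]; push_cast; linarith
    · have h1 : (1 : ℝ) ≤ doublings (1 + n / ε) := by exact_mod_cast h0
      nlinarith
  rw [halfWidth]
  push_cast
  have hK : (0 : ℝ) ≤ K := Nat.cast_nonneg _
  nlinarith

/-- The half-width is `K` times `t + 1` with `2 ^ t` at most `2 * Y ^ 2`, so the number of masks is
polynomial in `Y`. The running time is bounded by its square times `100 * (n + 1)`, plus `4 * 2 ^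
t`; hence the constants `400 * 256 ^ K` and `8`. -/
theorem runningTime_halfWidth_le (K n : ℕ) {ε : ℝ} (hε : 0 < ε) :
    (runningTime n (halfWidth K n ε) (doublings (1 + n / ε)) : ℝ) ≤
      ((400 * 256 ^ K + 8 : ℕ) : ℝ) * (n + 1 / ε + 1) ^ (8 * K + 2) := by
  have hn : (0 : ℝ) ≤ n := Nat.cast_nonneg _
  have hi : 0 < 1 / ε := by positivity
  set Y : ℝ := n + 1 / ε + 1 with hY
  have hY1 : 1 ≤ Y := by linarith
  have hx : (1 : ℝ) ≤ 1 + n / ε := le_add_of_nonneg_right (by positivity)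
  have hxY : 1 + n / ε ≤ Y ^ 2 := by
    rw [div_eq_mul_one_div, hY]
    nlinarith
  set t := doublings (1 + n / ε) with ht
  have h2t : (2 : ℝ) ^ t ≤ 2 * Y ^ 2 := (two_pow_doublings_le hx).trans (by linarith)
  have hP : (2 : ℝ) ^ (2 * halfWidth K n ε + 1) ≤ 2 * 16 ^ K * Y ^ (4 * K) := by
    calc (2 : ℝ) ^ (2 * halfWidth K n ε + 1) = 2 * 4 ^ K * (2 ^ t) ^ (2 * K) := by
          rw [halfWidth, ← ht, show (4 : ℝ) = 2 ^ 2 by norm_num, ← pow_mul, ← pow_mul, mul_assoc,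
            ← pow_add, ← pow_succ']
          congr 1
          ring
      _ ≤ 2 * 4 ^ K * (2 * Y ^ 2) ^ (2 * K) := by gcongr
      _ = 2 * 16 ^ K * Y ^ (4 * K) := by
          rw [mul_pow, ← pow_mul, pow_mul 2 2 K, show (16 : ℝ) = 4 * 2 ^ 2 by norm_num, mul_pow 4]
          ring_nf
  have h := runningTime_le n (halfWidth K n ε) t
  have h' : (runningTime n (halfWidth K n ε) t : ℝ) ≤
      100 * ((n + 1) * 2 ^ (2 * halfWidth K n ε + 1) * 2 ^ (2 * halfWidth K n ε + 1)) +
        4 * 2 ^ t := by exact_mod_cast h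
  refine h'.trans ?_
  calc 100 * (((n : ℝ) + 1) * 2 ^ (2 * halfWidth K n ε + 1) * 2 ^ (2 * halfWidth K n ε + 1)) +
        4 * 2 ^ t
      ≤ 100 * (Y * (2 * 16 ^ K * Y ^ (4 * K)) * (2 * 16 ^ K * Y ^ (4 * K))) + 4 * (2 * Y ^ 2) := by
        gcongr
        linarith
    _ = 400 * 256 ^ K * Y ^ (8 * K + 1) + 8 * Y ^ 2 := by
        rw [show (256 : ℝ) = 16 * 16 by norm_num, mul_pow]
        ring
    _ ≤ 400 * 256 ^ K * Y ^ (8 * K + 2) + 8 * Y ^ (8 * K + 2) := by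
        gcongr <;> first | exact hY1 | omega
    _ = _ := by push_cast; ring

end RealRAM

/-! ### Assembly -/

theorem theorem2 (α β : ℝ) (hα : 1 ≤ α) (hβ : 0 < β) :
    ∃ (estimator sampler : RealRAM.Prog) (C D : ℕ) (K : ℝ) (k : ℕ → ℝ → ℕ),
      estimator.Deterministic ∧
      ∀ (n : ℕ) (ε : ℝ), 0 < ε →
        ∃ T : ℕ, (T : ℝ) ≤ C * (n + 1 / ε + 1) ^ D ∧
          -- the half-width of the band
          (k n ε : ℝ) ≤ K * (1 + Real.log (1 + n / ε)) ∧
          -- (i) estimation of the partition function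
          (estimator.HaltsWithin (RealRAM.input n α β ε) T ∧
            ∃ Zhat : ℝ,
              (estimator.memoryAfter (RealRAM.input n α β ε) T).map RealRAM.State.realOutput = PMF.pure Zhat ∧
              Zhat = (Mallows.bandMatrix n α β (k n ε)).permanent ∧
              ∀ σ : Equiv.Perm (Fin n),
                (1 - ε) * Mallows.partitionFunction α β σ ≤ Zhat ∧ Zhat ≤ Mallows.partitionFunction α β σ) ∧
          -- (ii) sampling
          ∀ σ : Equiv.Perm (Fin n),
            sampler.HaltsWithin (RealRAM.inputWithCenter α β ε σ) T ∧
            ∃ ν : PMF (Equiv.Perm (Fin n)),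
              (sampler.memoryAfter (RealRAM.inputWithCenter α β ε σ) T).map (RealRAM.State.listOutput n) =
                ν.map Mallows.values ∧
              ν = Mallows.truncatedMallows α β (k n ε) σ ∧
              Mallows.tvDist ν (Mallows.mallows α β σ) ≤ ε := by
  obtain ⟨K, hK⟩ := Mallows.exists_sum_weight_not_inBand_le hα hβ
  have hα0 : α ≠ 0 := by linarith
  refine ⟨RealRAM.estimatorProg K, RealRAM.samplerProg K, 400 * 256 ^ K + 8, 8 * K + 2, 2 * K,
    RealRAM.halfWidth K, RealRAM.estimatorProg_deterministic K, fun n ε hε => ?_⟩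
  have hacc : ∑ π : Equiv.Perm (Fin n) with ¬ Mallows.InBand (RealRAM.halfWidth K n ε) π,
      Mallows.weight α β π ≤ ε * ∑ π : Equiv.Perm (Fin n), Mallows.weight α β π := by
    -- The decay is used with `doublings (1 + n / ε) + 1` halvings: the additional one cancels the
    -- factor `2` of the union bound, the others bring `n` down to at most `ε`.
    refine (hK n _).trans (mul_le_mul_of_nonneg_right ?_ (Mallows.sum_weight_pos n α β).le)
    have h := RealRAM.le_two_pow_doublings (1 + n / ε)
    have h1 : (n : ℝ) / ε ≤ 2 ^ RealRAM.doublings (1 + n / ε) := by linarith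
    rw [div_le_iff₀ hε] at h1
    rw [pow_succ, one_div, inv_pow]
    have hpos : (0 : ℝ) < 2 ^ RealRAM.doublings (1 + n / ε) := by positivity
    rw [show 2 * (n : ℝ) * ((2 ^ RealRAM.doublings (1 + n / ε))⁻¹ * 2⁻¹) =
      n / 2 ^ RealRAM.doublings (1 + n / ε) by field_simp, div_le_iff₀ hpos]
    linarith
  refine ⟨RealRAM.runningTime n (RealRAM.halfWidth K n ε) (RealRAM.doublings (1 + n / ε)),
    RealRAM.runningTime_halfWidth_le K n hε, RealRAM.halfWidth_le K n hε, ?_, fun σ => ?_⟩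
  · have h := RealRAM.triple_estimatorProg K hα0 (RealRAM.start_input n α β ε) rfl
    refine ⟨h.haltsWithin, _, ?_, rfl, fun σ => ⟨Mallows.le_permanent_bandMatrix σ hacc,
      Mallows.permanent_bandMatrix_le α β _ σ⟩⟩
    rw [h.map_memoryAfter (g := fun _ =>
      (Mallows.bandMatrix n α β (RealRAM.halfWidth K n ε)).permanent) fun _ _ h => h, PMF.pure_map]
  · have h := RealRAM.triple_samplerProg K hα0 σ (RealRAM.start_inputWithCenter α β ε σ)
      (fun i => by simp) rfl
    refine ⟨h.haltsWithin, _, ?_, rfl, Mallows.tvDist_truncatedMallows_le σ hacc⟩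
    rw [h.map_memoryAfter (g := id) fun _ _ h => h, PMF.map_id]
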